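/- Let $n\ge 0$ and let $\lambda\vdash n$ be a partition, identified with its Ferrers diagram in English notation (longest row on top). Write $[n]=\{1,\dots,n\}$ and $(q;q)_n=(1-q)(1-q^2)\cdots(1-q^n)$, where $q,t$ are formal variables. *Super Schur functions.* A standard tableau of shape $\lambda$ is a bijection $T:\lambda\to[n]$ strictly increasing along rows and columns; $\mathrm{SYT}(\lambda)$ is the set of these, and $\mathrm{Des}(T)$ is the set of $i\in\{1,\dots,n-1\}$ such that $i+1$ appears in a strictly lower row of $T$ than $i$. Let $\mathcal A=\mathcal A_+\sqcup\mathcal A_-=\{1<\overline 1<2<\overline 2<\cdots\}$ with $\mathcal A_+=\{1,2,\dots\}$ and $\mathcal A_-=\{\overline 1,\overline 2,\dots\}$, and put $z_i=x_i$, $z_{\overline i}=y_i$. For $D\subseteq\{1,\dots,n-1\}$ let $$\widetilde Q_{n,D}(\mathbf x;\mathbf y)=\sum z_{a_1}z_{a_2}\cdots z_{a_n},$$ the sum being over sequences $a_1\le a_2\le\cdots\le a_n$ in $\mathcal A$ such that $a_i=a_{i+1}\in\mathcal A_+$ implies $i\notin D$, and $a_i=a_{i+1}\in\mathcal A_-$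 implies $i\in D$. The super Schur function is $$\widetilde s_\lambda(\mathbf x;\mathbf y)=\sum_{T\in\mathrm{SYT}(\lambda)}\widetilde Q_{n,\mathrm{Des}(T)}(\mathbf x;\mathbf y).$$ *Standard super tableaux.* A standard super tableau of shape $\lambda$ is a map $\mathcal T:\lambda\to\mathcal A$ that is strictly increasing along rows and columns and contains exactly one of $i$, $\overline i$ for each $i\in[n]$; $\mathrm{SYT}_\pm(\lambda)$ is the set of these. Let $\mathcal T_+\in\mathrm{SYT}(\lambda)$ be obtained from $\mathcal T$ by replacing each $\overline i$ with $i$, let $\mathrm{Neg}(\mathcal T)=\{i:\overline i\in\mathcal T\}$ and $\mathrm{neg}(\mathcal T)=|\mathrm{Neg}(\mathcal T)|$. Let $\mathrm{Des}(\mathcal T)$ be the set of $i\in\{1,\dots,n-1\}$ such that either $i\in\mathrm{Des}(\mathcal T_+)$ and $i+1\notin\mathrm{Neg}(\mathcal T)$, or $i\notin\mathrm{Des}(\mathcal T_+)$ and $i\in\mathrm{Neg}(\mathcal T)$. Put $$\mathrm{maj}(\mathcal T)=\sum_{i\in\mathrm{Des}(\mathcal T)}i,\qquad \mathrm{comaj}(\mathcal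 T)=\sum_{i\in\mathrm{Des}(\mathcal T)}(n-i).$$ **Theorem.** The specialization of $\widetilde s_\lambda(\mathbf x;\mathbf y)$ at $x_i=q^{i-1}$, $y_i=tq^{i-1}$ $(i\ge1)$ is well defined (the series obtained by substituting into each monomial converges in $\mathbb Z[[q,t]]$, coefficient by coefficient), and $$\widetilde s_\lambda(1,q,q^2,\ldots;t,tq,tq^2,\ldots)=\frac1{(q;q)_n}\sum_{\mathcal T\in\mathrm{SYT}_\pm(\lambda)}q^{\mathrm{comaj}(\mathcal T)}t^{\mathrm{neg}(\mathcal T)}=\frac1{(q;q)_n}\sum_{\mathcal T\in\mathrm{SYT}_\pm(\lambda)}q^{\mathrm{maj}(\mathcal T)}t^{\mathrm{neg}(\mathcal T)}.$$ -/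

import Mathlib

open scoped MvPowerSeries.WithPiTopology

noncomputable section

namespace SuperTableau

/-- The alphabet `𝒜 = {1 < 1̄ < 2 < 2̄ < ⋯}`, in its lexicographic order: the letter `i` is
`(i, false)` and the letter `ī` is `(i, true)`. -/
abbrev Letter : Type := ℕ+ ×ₗ Bool

/-- The positive letter `i`. -/
def Letter.pos (i : ℕ+) : Letter := toLex (i, false)

/-- The negative letter `ī`. -/
def Letter.bar (i : ℕ+) : Letter := toLex (i, true)

/-- The projection `𝒜 → 𝒜₊`, `i ↦ i`, `ī ↦ i`. -/
def Letter.proj (a : Letter) : ℕ+ := (ofLex a).1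

/-- Whether a letter lies in `𝒜₋`. -/
def Letter.IsNeg (a : Letter) : Prop := (ofLex a).2 = true

/-! ### Standard tableaux and their descents -/

/-- A standard tableau of shape `μ`: a bijection from the cells of `μ` onto `{1, …, |μ|}`, strictly
increasing along rows and columns. Cells are pairs (row, column); row `0` is the top,
longest row. -/
structure StandardTableau (μ : YoungDiagram) where
  entry : μ.cells → ℕ
  bijOn : Set.BijOn entry Set.univ (Set.Icc 1 μ.card)
  row_lt : ∀ c d : μ.cells, c.1.1 = d.1.1 → c.1.2 < d.1.2 → entry c < entry d
  col_lt : ∀ c d : μ.cells, c.1.2 = d.1.2 → c.1.1 < d.1.1 → entry c < entry d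

theorem StandardTableau.finite (μ : YoungDiagram) : Finite (StandardTableau μ) := by
  refine Finite.of_injective
    (fun T : StandardTableau μ => fun c =>
      (⟨T.entry c, T.bijOn.mapsTo (Set.mem_univ c)⟩ : Set.Icc 1 μ.card)) ?_
  rintro ⟨e, _, _, _⟩ ⟨e', _, _, _⟩ h
  have : e = e' := by
    funext c
    exact congrArg Subtype.val (congrFun h c)
  subst this
  rfl

instance (μ : YoungDiagram) : Fintype (StandardTableau μ) :=
  @Fintype.ofFinite _ (StandardTableau.finite μ)

open Classical in
/-- The descent set: those `i ∈ {1, …, n - 1}` such that `i + 1` appears in a strictly lower row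
than `i`. -/
def StandardTableau.des {μ : YoungDiagram} (T : StandardTableau μ) : Finset ℕ :=
  (Finset.Ico 1 μ.card).filter fun i =>
    ∃ c d : μ.cells, T.entry c = i ∧ T.entry d = i + 1 ∧ c.1.1 < d.1.1

/-! ### Standard super tableaux and their statistics -/

/-- A standard super tableau of shape `μ`: a filling of the cells by letters of `𝒜`, strictly
increasing along rows and columns, which contains exactly one of `i`, `ī` for each
`i = 1, …, |μ|`. -/
structure StandardSuperTableau (μ : YoungDiagram) where
  entry : μ.cells → Letter
  row_lt : ∀ c d : μ.cells, c.1.1 = d.1.1 → c.1.2 < d.1.2 → entry c < entry d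
  col_lt : ∀ c d : μ.cells, c.1.2 = d.1.2 → c.1.1 < d.1.1 → entry c < entry d
  exactly_one : ∀ i : ℕ+, (i : ℕ) ≤ μ.card →
    Xor (∃ c, entry c = Letter.pos i) (∃ c, entry c = Letter.bar i)

namespace StandardSuperTableau

variable {μ : YoungDiagram}

theorem proj_bijOn (T : StandardSuperTableau μ) :
    Set.BijOn (fun c => ((T.entry c).proj : ℕ)) Set.univ (Set.Icc 1 μ.card) := by
  classical
  set f : μ.cells → ℕ := fun c => ((T.entry c).proj : ℕ) with hf
  have hsub : Finset.Icc 1 μ.card ⊆ Finset.univ.image f := by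
    intro i hi
    rw [Finset.mem_Icc] at hi
    have key : ∃ c, (T.entry c).proj = ⟨i, hi.1⟩ := by
      rcases T.exactly_one ⟨i, hi.1⟩ hi.2 with ⟨⟨c, hc⟩, _⟩ | ⟨⟨c, hc⟩, _⟩
      · exact ⟨c, by rw [hc]; rfl⟩
      · exact ⟨c, by rw [hc]; rfl⟩
    obtain ⟨c, hc⟩ := key
    exact Finset.mem_image.2 ⟨c, Finset.mem_univ c, by simp [hf, hc]⟩
  have hle : (Finset.univ.image f).card ≤ (Finset.univ : Finset μ.cells).card :=
    Finset.card_image_le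
  have hcard : (Finset.univ : Finset μ.cells).card = μ.card := by simp
  have heq : Finset.Icc 1 μ.card = Finset.univ.image f :=
    Finset.eq_of_subset_of_card_le hsub (by rw [Nat.card_Icc]; omega)
  have hinj : Set.InjOn f (Finset.univ : Finset μ.cells) := by
    rw [← Finset.card_image_iff, ← heq, Nat.card_Icc, hcard]
    omega
  refine ⟨fun c _ => ?_, by simpa using hinj, fun i hi => ?_⟩
  · have : f c ∈ Finset.Icc 1 μ.card := by
      rw [heq]
      exact Finset.mem_image_of_mem f (Finset.mem_univ c)
    simpa using this
  · obtain ⟨c, _, hc⟩ := Finset.mem_image.1 (hsub (Finset.mem_Icc.2 hi))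
    exact ⟨c, Set.mem_univ c, hc⟩

theorem proj_lt (T : StandardSuperTableau μ) {c d : μ.cells} (h : T.entry c < T.entry d) :
    ((T.entry c).proj : ℕ) < ((T.entry d).proj : ℕ) := by
  have hne : ((T.entry c).proj : ℕ) ≠ ((T.entry d).proj : ℕ) := by
    intro he
    have := T.proj_bijOn.injOn (Set.mem_univ c) (Set.mem_univ d) he
    subst this
    exact lt_irrefl _ h
  refine lt_of_le_of_ne ?_ hne
  rcases (Prod.Lex.lt_iff).1 h with h | h
  · exact le_of_lt h
  · exact le_of_eq (congrArg PNat.val h.1)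

theorem finite (μ : YoungDiagram) : Finite (StandardSuperTableau μ) := by
  refine Finite.of_injective
    (fun T : StandardSuperTableau μ => fun c =>
      ((⟨((T.entry c).proj : ℕ), T.proj_bijOn.mapsTo (Set.mem_univ c)⟩ : Set.Icc 1 μ.card),
        (ofLex (T.entry c)).2)) ?_
  rintro ⟨e, _, _, _⟩ ⟨e', _, _, _⟩ h
  have : e = e' := by
    funext c
    have h1 := congrFun h c
    refine ofLex.injective (Prod.ext ?_ ?_)
    · exact PNat.eq (congrArg (fun p => (p.1 : ℕ)) h1)
    · exact congrArg (fun p => p.2) h1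
  subst this
  rfl

instance (μ : YoungDiagram) : Fintype (StandardSuperTableau μ) :=
  @Fintype.ofFinite _ (finite μ)

/-- The standard tableau `𝒯₊`, the image of `𝒯` under the projection `𝒜 → 𝒜₊`. -/
def plus (T : StandardSuperTableau μ) : StandardTableau μ where
  entry c := ((T.entry c).proj : ℕ)
  bijOn := T.proj_bijOn
  row_lt c d h h' := T.proj_lt (T.row_lt c d h h')
  col_lt c d h h' := T.proj_lt (T.col_lt c d h h')

open Classical in
/-- `Neg(𝒯)`: the set of all `i` such that `ī` is an entry of `𝒯`. -/
def negSet (T : StandardSuperTableau μ) : Finset ℕ :=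
  (Finset.Icc 1 μ.card).filter fun i => ∃ c, ∃ k : ℕ+, (k : ℕ) = i ∧ T.entry c = Letter.bar k

/-- `neg(𝒯) = |Neg(𝒯)|`. -/
def neg (T : StandardSuperTableau μ) : ℕ := T.negSet.card

/-- The super descent set of `𝒯`. -/
def des (T : StandardSuperTableau μ) : Finset ℕ :=
  (Finset.Ico 1 μ.card).filter fun i =>
    (i ∈ T.plus.des ∧ i + 1 ∉ T.negSet) ∨ (i ∉ T.plus.des ∧ i ∈ T.negSet)

/-- The major index of `𝒯`. -/
def maj (T : StandardSuperTableau μ) : ℕ := ∑ i ∈ T.des, i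

/-- The comajor index of `𝒯`. -/
def comaj (T : StandardSuperTableau μ) : ℕ := ∑ i ∈ T.des, (μ.card - i)

end StandardSuperTableau

/-! ### Super quasisymmetric and super Schur functions

They are formal power series in variables `z_a`, `a ∈ 𝒜`, where `z_i = x_i` and `z_ī = y_i`. -/

/-- The index set of the sum defining `Q̃_{n,D}`: sequences `a₁ ≤ ⋯ ≤ aₙ` in `𝒜` such that
`aᵢ = aᵢ₊₁ ∈ 𝒜₊` implies `i ∉ D` and `aᵢ = aᵢ₊₁ ∈ 𝒜₋` implies `i ∈ D`. Here `aᵢ` is `a (i - 1)`. -/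
def IsAdmissible (n : ℕ) (D : Finset ℕ) (a : Fin n → Letter) : Prop :=
  Monotone a ∧
    ∀ (j : ℕ) (hj : j + 1 < n), a ⟨j, Nat.lt_of_succ_lt hj⟩ = a ⟨j + 1, hj⟩ →
      (¬ (a ⟨j, Nat.lt_of_succ_lt hj⟩).IsNeg → j + 1 ∉ D) ∧
      ((a ⟨j, Nat.lt_of_succ_lt hj⟩).IsNeg → j + 1 ∈ D)

/-- The exponent of the monomial `z_{a₁} ⋯ z_{aₙ}`. -/
def content {n : ℕ} (a : Fin n → Letter) : Letter →₀ ℕ := ∑ j, Finsupp.single (a j) 1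

/-- Only finitely many sequences contribute to any given monomial. -/
theorem finite_content_eq (n : ℕ) (m : Letter →₀ ℕ) :
    {a : Fin n → Letter | content a = m}.Finite := by
  refine Set.Finite.subset (Set.Finite.pi' fun _ : Fin n => m.support.finite_toSet) ?_
  rintro a rfl j
  rw [Finset.mem_coe, Finsupp.mem_support_iff, content, Finsupp.finsetSum_apply]
  have h : (Finsupp.single (a j) 1 : Letter →₀ ℕ) (a j) ≤
      ∑ i, (Finsupp.single (a i) 1 : Letter →₀ ℕ) (a j) :=
    Finset.single_le_sum (f := fun i => (Finsupp.single (a i) 1 : Letter →₀ ℕ) (a j))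
      (fun _ _ => Nat.zero_le _) (Finset.mem_univ j)
  rw [Finsupp.single_eq_same] at h
  omega

/-- The super quasisymmetric function `Q̃_{n,D} = ∑ z_{a₁} ⋯ z_{aₙ}` over admissible sequences:
the coefficient of a monomial is the number of admissible sequences that give it. -/
def superQ (n : ℕ) (D : Finset ℕ) : MvPowerSeries Letter ℤ :=
  fun m => (Set.ncard {a : Fin n → Letter | IsAdmissible n D a ∧ content a = m} : ℤ)

/-- The super Schur function `s̃_μ = ∑_{T ∈ SYT(μ)} Q̃_{|μ|, Des(T)}`. -/
def superSchur (μ : YoungDiagram) : MvPowerSeries Letter ℤ :=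
  ∑ T : StandardTableau μ, superQ μ.card T.des

/-! ### Principal specialization -/

/-- The ring `ℤ[[q, t]]`. -/
abbrev QT : Type := MvPowerSeries (Fin 2) ℤ

/-- The variable `q`. -/
def q : QT := MvPowerSeries.X 0

/-- The variable `t`. -/
def t : QT := MvPowerSeries.X 1

/-- The values `x_i = q ^ (i - 1)` and `y_i = t * q ^ (i - 1)`. -/
def principalValue (a : Letter) : QT :=
  (if (ofLex a).2 then t else 1) * q ^ ((a.proj : ℕ) - 1)

/-- `g` is the specialization `f(1, q, q², …; t, tq, tq², …)`: the series obtained by substituting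
the values into each monomial of `f` converges to `g` in `ℤ[[q, t]]`, coefficient by coefficient
(the product topology, with `ℤ` discrete). As this topology is Hausdorff, there is at most one
such `g`. -/
def IsPrincipalSpecialization (f : MvPowerSeries Letter ℤ) (g : QT) : Prop :=
  HasSum (fun m : Letter →₀ ℕ =>
    MvPowerSeries.coeff m f • m.prod fun a k => principalValue a ^ k) g

/-- The `q`-Pochhammer symbol `(a; b)_n = (1 - a)(1 - ab) ⋯ (1 - ab^{n-1})`. -/
def pochhammer (a b : QT) (n : ℕ) : QT := ∏ k ∈ Finset.range n, (1 - a * b ^ k)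

/-- `(q; q)_n` as a unit of `ℤ[[q, t]]`; its constant coefficient is `1`. -/
def pochhammerUnit (n : ℕ) : QTˣ where
  val := pochhammer q q n
  inv := MvPowerSeries.invOfUnit (pochhammer q q n) 1
  val_inv := MvPowerSeries.mul_invOfUnit _ _ (by simp [pochhammer, q])
  inv_val := by
    rw [mul_comm]
    exact MvPowerSeries.mul_invOfUnit _ _ (by simp [pochhammer, q])

end SuperTableau

end

/-! A letter is a pair (block, sign), so a sequence of letters is a block sequence `u` together with
a sign sequence `ε`. For a fixed tableau `T` and fixed `ε`, admissibility says exactly that `u`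
increases weakly, and strictly at the super descents (`isAdmissible_letterSeq`). Removing the first
term of `u` repeatedly, as for P-partitions, gives `q ^ comaj / (q;q)_n` (`hasSum_compatible_lt`).
Summing over `T` and `ε` proves the comajor formula.

Reversing positions shows that `q ^ maj / (q;q)_n` counts the weakly decreasing `u` with the same
strictness conditions (`hasSum_compatible_gt`). The equality of the two sums is therefore a
symmetry: listing the blocks in decreasing order must give the same generating function. It fails
for individual tableaux and holds only after summing over `T` and `ε`.

The symmetry comes from a noncommutative argument in the style of Fomin and Greene. Record `T` by
the word of diagonals of its cells 1, 2, …, n; descents of `T` are descents of this word. The number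
of tableaux with a given word respects the nil Temperley–Lieb relations (`wordCount`): cells on one
diagonal have entries at least 3 apart, and consecutive entries on distant diagonals can be
exchanged. A block with value `x` contributes an increasing product of factors `1 + x U_c` for its
positive letters and a decreasing product with parameter `t x` for its negative ones. Such block
products commute for different `x` (`superProd_comm`, by Yang–Baxter), so finitely many blocks may
be reversed; then the number of blocks tends to infinity. -/

noncomputable section

namespace SuperTableau

/-! ### Generating functions in a nilCoxeter algebra -/

section NilCoxeter

variable {A R : Type*} [CommRing A] [Ring R] [Algebra A R]

/-- The relations satisfied by the operators that add a cell on a given diagonal: those of the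
nilCoxeter algebra, with both sides of the braid relation equal to `0`. -/
structure IsNilTemperleyLieb (U : ℕ → R) : Prop where
  sq : ∀ c, U c * U c = 0
  up : ∀ c, U c * U (c + 1) * U c = 0
  down : ∀ c, U (c + 1) * U c * U (c + 1) = 0
  comm : ∀ c d, c + 2 ≤ d → U c * U d = U d * U c

/-- The product of the `1 + x U_c` in increasing order of `c < M`. -/
def incProd (U : ℕ → R) (M : ℕ) (x : A) : R :=
  ((List.range M).map fun c => 1 + x • U c).prod

/-- The product of the `1 + x U_c` in decreasing order of `c < M`. -/
def decProd (U : ℕ → R) (M : ℕ) (x : A) : R :=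
  ((List.range M).reverse.map fun c => 1 + x • U c).prod

theorem incProd_succ (U : ℕ → R) (M : ℕ) (x : A) :
    incProd U (M + 1) x = incProd U M x * (1 + x • U M) := by
  simp [incProd, List.range_succ]

theorem decProd_succ (U : ℕ → R) (M : ℕ) (x : A) :
    decProd U (M + 1) x = (1 + x • U M) * decProd U M x := by
  simp [decProd, List.range_succ]

namespace IsNilTemperleyLieb

variable {U : ℕ → R} (h : IsNilTemperleyLieb U)
include h

theorem factor_mul (c : ℕ) (x y : A) :
    (1 + x • U c) * (1 + y • U c) = 1 + (x + y) • U c := by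
  simp only [mul_add, add_mul, one_mul, mul_one, smul_mul_assoc, mul_smul_comm, h.sq, smul_zero,
    add_smul]
  rw [add_assoc, add_zero]

theorem factor_comm (c : ℕ) (x y : A) : Commute (1 + x • U c) (1 + y • U c) := by
  rw [Commute, SemiconjBy, h.factor_mul, h.factor_mul, add_comm x y]

/-- Both braid words are zero, so no cubic term survives. The linear and quadratic terms agree
because the middle parameter is the sum of the outer ones. -/
theorem yangBaxter (c : ℕ) (x y : A) :
    (1 + x • U (c + 1)) * (1 + (x + y) • U c) * (1 + y • U (c + 1)) =
      (1 + y • U c) * (1 + (x + y) • U (c + 1)) * (1 + x • U c) := by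
  have h1 := h.up c
  have h2 := h.down c
  simp only [mul_add, add_mul, one_mul, mul_one, smul_mul_assoc, mul_smul_comm, h.sq, smul_zero,
    add_smul, h1, h2, smul_add, smul_smul]
  rw [mul_comm y x]
  module

theorem commute_incProd (M d : ℕ) (hd : M + 1 ≤ d) (x y : A) :
    Commute (1 + x • U d) (incProd U M y) := by
  refine Commute.list_prod_right _ _ fun z hz => ?_
  obtain ⟨c, hc, rfl⟩ := List.mem_map.1 hz
  rw [List.mem_range] at hc
  have hcd : Commute (U d) (U c) := (h.comm c d (by omega)).symm
  exact ((Commute.one_left _).add_left (((Commute.one_right _).add_right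
    (hcd.smul_right y)).smul_left x))

/-- The inductive step must expose the last two factors, so it passes from `M + 1` to `M + 2`;
pairing two consecutive lengths also covers length 0. -/
theorem incProd_comm_aux (M : ℕ) (x y : A) :
    Commute (incProd U M x) (incProd U M y) ∧
      Commute (incProd U (M + 1) x) (incProd U (M + 1) y) := by
  induction M with
  | zero => simpa [incProd] using h.factor_comm 0 x y
  | succ M ih =>
    refine ⟨ih.2, ?_⟩
    have e : ∀ z : A, incProd U (M + 1 + 1) z =
        incProd U M z * (1 + z • U M) * (1 + z • U (M + 1)) := fun z => by
      rw [incProd_succ, incProd_succ]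
    have c1 : ∀ z w : A, (1 + z • U (M + 1)) * incProd U M w =
        incProd U M w * (1 + z • U (M + 1)) := fun z w =>
      (h.commute_incProd M (M + 1) le_rfl z w)
    have i2 : incProd U M x * (1 + x • U M) * (incProd U M y * (1 + y • U M)) =
        incProd U M y * (1 + y • U M) * (incProd U M x * (1 + x • U M)) := by
      have := ih.2
      rw [Commute, SemiconjBy, incProd_succ, incProd_succ] at this
      exact this
    -- The third parameter `y - x` is what remains of `y` once a factor with parameter `x` is split
    -- off on the right, as in `s1`; this makes `y` the sum of the outer parameters.
    have yb : (1 + x • U (M + 1)) * (1 + y • U M) * (1 + (y - x) • U (M + 1)) =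
        (1 + (y - x) • U M) * (1 + y • U (M + 1)) * (1 + x • U M) := by
      have := h.yangBaxter M x (y - x)
      rwa [add_sub_cancel] at this
    have s1 : (1 + y • U (M + 1)) = (1 + (y - x) • U (M + 1)) * (1 + x • U (M + 1)) := by
      rw [h.factor_mul]; simp
    have s2 : (1 + (y - x) • U M) = (1 + y • U M) * (1 + (-x) • U M) := by
      rw [h.factor_mul, sub_eq_add_neg]
    have s3 : (1 + x • U M) * (1 + (-x) • U M) = 1 := by
      rw [h.factor_mul]; simp
    rw [Commute, SemiconjBy, e, e]
    calc incProd U M x * (1 + x • U M) * (1 + x • U (M + 1)) *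
          (incProd U M y * (1 + y • U M) * (1 + y • U (M + 1)))
        = incProd U M x * (1 + x • U M) * ((1 + x • U (M + 1)) * incProd U M y) *
          (1 + y • U M) * (1 + y • U (M + 1)) := by simp only [mul_assoc]
      _ = incProd U M x * (1 + x • U M) * incProd U M y *
          ((1 + x • U (M + 1)) * (1 + y • U M) * (1 + (y - x) • U (M + 1))) *
            (1 + x • U (M + 1)) := by
          rw [c1]
          nth_rewrite 1 [s1]
          simp only [mul_assoc]
      _ = (incProd U M x * (1 + x • U M) * (incProd U M y * (1 + y • U M))) *
          (1 + (-x) • U M) * (1 + y • U (M + 1)) * (1 + x • U M) * (1 + x • U (M + 1)) := by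
          rw [yb, s2]; simp only [mul_assoc]
      _ = incProd U M y * (1 + y • U M) * incProd U M x *
          ((1 + x • U M) * (1 + (-x) • U M)) * (1 + y • U (M + 1)) * (1 + x • U M) *
            (1 + x • U (M + 1)) := by
          rw [i2]; simp only [mul_assoc]
      _ = incProd U M y * (1 + y • U M) * (incProd U M x * (1 + y • U (M + 1))) * (1 + x • U M) *
            (1 + x • U (M + 1)) := by
          rw [s3]; simp only [mul_assoc, one_mul]
      _ = _ := by
          rw [← c1]; simp only [mul_assoc]

theorem incProd_comm (M : ℕ) (x y : A) : Commute (incProd U M x) (incProd U M y) :=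
  (h.incProd_comm_aux M x y).1

theorem incProd_mul_decProd (M : ℕ) (x : A) : incProd U M x * decProd U M (-x) = 1 := by
  induction M with
  | zero => simp [incProd, decProd]
  | succ M ih =>
    rw [incProd_succ, decProd_succ, mul_assoc, ← mul_assoc (1 + x • U M), h.factor_mul]
    simpa using ih

theorem decProd_mul_incProd (M : ℕ) (x : A) : decProd U M (-x) * incProd U M x = 1 := by
  induction M with
  | zero => simp [incProd, decProd]
  | succ M ih =>
    rw [incProd_succ, decProd_succ, mul_assoc, ← mul_assoc (decProd U M _), ih, one_mul,
      h.factor_mul]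
    simp

/-- `decProd U M x` is the inverse of `incProd U M (-x)`. -/
def decUnit (M : ℕ) (x : A) : Rˣ where
  val := incProd U M (-x)
  inv := decProd U M x
  val_inv := by simpa using h.incProd_mul_decProd M (-x)
  inv_val := by simpa using h.decProd_mul_incProd M (-x)

/-- A decreasing product is the inverse of an increasing one with opposite parameter, so commutation
is inherited from `incProd_comm`. -/
theorem incProd_comm_decProd (M : ℕ) (x y : A) : Commute (incProd U M x) (decProd U M y) :=
  Commute.units_inv_right (u := h.decUnit M y) (h.incProd_comm M x (-y))

theorem decProd_comm (M : ℕ) (x y : A) : Commute (decProd U M x) (decProd U M y) :=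
  Commute.units_inv_left (u := h.decUnit M x)
    (h.incProd_comm_decProd M (-x) y)

theorem superProd_comm (M : ℕ) (x x' y y' : A) :
    Commute (incProd U M x * decProd U M y) (incProd U M x' * decProd U M y') :=
  ((h.incProd_comm M x x').mul_right (h.incProd_comm_decProd M x y')).mul_left
    ((h.incProd_comm_decProd M x' y).symm.mul_right (h.decProd_comm M y y'))

end IsNilTemperleyLieb

end NilCoxeter

/-! ### Functionals on words -/

section Words

variable (A : Type*) [CommRing A]

/-- The functions on words that are compatible with the relations of `IsNilTemperleyLieb`. -/
def wordFunctional : Submodule A (List ℕ → A) where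
  carrier := {f | (∀ a b c, f (a ++ [c, c] ++ b) = 0) ∧ (∀ a b c d, f (a ++ [c, d, c] ++ b) = 0) ∧
    ∀ a b c d, c + 2 ≤ d → f (a ++ [c, d] ++ b) = f (a ++ [d, c] ++ b)}
  add_mem' := by
    rintro f g ⟨h1, h2, h3⟩ ⟨h1', h2', h3'⟩
    refine ⟨fun a b c => ?_, fun a b c d => ?_, fun a b c d h => ?_⟩
    · rw [Pi.add_apply, h1, h1', add_zero]
    · rw [Pi.add_apply, h2, h2', add_zero]
    · rw [Pi.add_apply, Pi.add_apply, h3 _ _ _ _ h, h3' _ _ _ _ h]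
  zero_mem' := ⟨fun _ _ _ => rfl, fun _ _ _ _ => rfl, fun _ _ _ _ _ => rfl⟩
  smul_mem' := by
    rintro z f ⟨h1, h2, h3⟩
    refine ⟨fun a b c => ?_, fun a b c d => ?_, fun a b c d h => ?_⟩
    · rw [Pi.smul_apply, h1, smul_zero]
    · rw [Pi.smul_apply, h2, smul_zero]
    · rw [Pi.smul_apply, Pi.smul_apply, h3 _ _ _ _ h]

/-- The operator `f ↦ (w ↦ f (w c))`. -/
def appendOp (c : ℕ) : Module.End A (wordFunctional A) where
  toFun f := ⟨fun w => f.1 (w ++ [c]), by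
    obtain ⟨h1, h2, h3⟩ := f.2
    refine ⟨fun a b d => ?_, fun a b d e => ?_, fun a b d e h => ?_⟩
    · simpa using h1 a (b ++ [c]) d
    · simpa using h2 a (b ++ [c]) d e
    · simpa using h3 a (b ++ [c]) d e h⟩
  map_add' _ _ := rfl
  map_smul' _ _ := rfl

variable {A}

@[simp] theorem appendOp_apply (c : ℕ) (f : wordFunctional A) (w : List ℕ) :
    (appendOp A c f).1 w = f.1 (w ++ [c]) := rfl

theorem isNilTemperleyLieb_appendOp : IsNilTemperleyLieb (appendOp A) where
  sq c := by
    ext f w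
    have := f.2.1 w [] c
    simpa [Module.End.mul_apply] using this
  up c := by
    ext f w
    have := f.2.2.1 w [] c (c + 1)
    simpa [Module.End.mul_apply] using this
  down c := by
    ext f w
    have := f.2.2.1 w [] (c + 1) c
    simpa [Module.End.mul_apply] using this
  comm c d h := by
    ext f w
    have := f.2.2.2 w [] c d h
    simpa [Module.End.mul_apply] using this

/-- Choosing a term in each factor selects a sublist. The leftmost operator is applied last and so
appends its letter to `w` first, hence words are read in the order of the product. -/
theorem prod_one_add_appendOp_apply {ι : Type*} (z : ι → A) (c : ι → ℕ) (l : List ι)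
    (f : wordFunctional A) (w : List ℕ) :
    ((l.map fun p => 1 + z p • appendOp A (c p)).prod f).1 w =
      (l.sublists'.map fun s => (s.map z).prod * f.1 (w ++ s.map c)).sum := by
  induction l generalizing w with
  | nil => simp
  | cons p l ih =>
    rw [List.map_cons, List.prod_cons, Module.End.mul_apply, LinearMap.add_apply,
      Module.End.one_apply, LinearMap.smul_apply, Submodule.coe_add, Pi.add_apply,
      Submodule.coe_smul, Pi.smul_apply, appendOp_apply, ih, ih, List.sublists'_cons,
      List.map_append, List.sum_append, List.map_map, smul_eq_mul, ← List.sum_map_mul_left]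
    simp [Function.comp_def, mul_assoc]

end Words

/-! ### The diagonal word of a standard tableau -/

section Diagonal

variable (μ : YoungDiagram)

/-- The diagonals of `μ`, numbered from the bottom left to the top right by natural numbers. -/
def diagonal (c : μ.cells) : ℕ := c.1.2 + (μ.cells.sup Prod.fst - c.1.1)

/-- A strict upper bound for the numbers of the diagonals of `μ`. -/
def diagonalBound : ℕ := μ.cells.sup Prod.snd + μ.cells.sup Prod.fst + 1

variable {μ}

theorem row_le_sup (c : μ.cells) : c.1.1 ≤ μ.cells.sup Prod.fst :=
  Finset.le_sup (f := Prod.fst) c.2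

theorem diagonal_lt_bound (c : μ.cells) : diagonal μ c < diagonalBound μ := by
  have : c.1.2 ≤ μ.cells.sup Prod.snd := Finset.le_sup (f := Prod.snd) c.2
  unfold diagonal diagonalBound
  omega

end Diagonal

namespace StandardTableau

variable {μ : YoungDiagram} (T : StandardTableau μ)

theorem ext_entry {T T' : StandardTableau μ} (h : T.entry = T'.entry) : T = T' := by
  cases T; cases T'; cases h; rfl

theorem entry_injective : Function.Injective T.entry :=
  Set.injOn_univ.1 T.bijOn.injOn

theorem entry_pos (c : μ.cells) : 1 ≤ T.entry c := (T.bijOn.mapsTo (Set.mem_univ c)).1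

theorem entry_le (c : μ.cells) : T.entry c ≤ μ.card := (T.bijOn.mapsTo (Set.mem_univ c)).2

theorem exists_entry {k : ℕ} (h1 : 1 ≤ k) (h2 : k ≤ μ.card) : ∃ c, T.entry c = k := by
  obtain ⟨c, -, hc⟩ := T.bijOn.surjOn (show k ∈ Set.Icc 1 μ.card from ⟨h1, h2⟩)
  exact ⟨c, hc⟩

theorem entry_le_of_le {c d : μ.cells} (h1 : c.1.1 ≤ d.1.1) (h2 : c.1.2 ≤ d.1.2) :
    T.entry c ≤ T.entry d := by
  have he : (c.1.1, d.1.2) ∈ μ.cells :=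
    μ.isLowerSet (a := d.1) (Prod.mk_le_mk.2 ⟨h1, le_rfl⟩) d.2
  have e1 : T.entry c ≤ T.entry ⟨_, he⟩ := by
    rcases h2.eq_or_lt with h | h
    · have : c = ⟨_, he⟩ := Subtype.ext (Prod.ext rfl h)
      rw [← this]
    · exact (T.row_lt c ⟨_, he⟩ rfl h).le
  have e2 : T.entry ⟨_, he⟩ ≤ T.entry d := by
    rcases h1.eq_or_lt with h | h
    · have : d = ⟨_, he⟩ := Subtype.ext (Prod.ext h.symm rfl)
      rw [← this]
    · exact (T.col_lt ⟨_, he⟩ d rfl h).le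
  exact e1.trans e2

/-- A cell strictly south-east of `c` has an entry that is larger by at least `3`. -/
theorem entry_add_three_le {c d : μ.cells} (h1 : c.1.1 < d.1.1) (h2 : c.1.2 < d.1.2) :
    T.entry c + 3 ≤ T.entry d := by
  have he : (c.1.1, d.1.2) ∈ μ.cells :=
    μ.isLowerSet (a := d.1) (Prod.mk_le_mk.2 ⟨h1.le, le_rfl⟩) d.2
  have he' : (d.1.1, c.1.2) ∈ μ.cells :=
    μ.isLowerSet (a := d.1) (Prod.mk_le_mk.2 ⟨le_rfl, h2.le⟩) d.2
  have a1 := T.row_lt c ⟨_, he⟩ rfl h2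
  have a2 := T.col_lt ⟨_, he⟩ d rfl h1
  have b1 := T.col_lt c ⟨_, he'⟩ rfl h1
  have b2 := T.row_lt ⟨_, he'⟩ d rfl h2
  have hne : T.entry ⟨_, he⟩ ≠ T.entry ⟨_, he'⟩ := by
    intro h
    have := congrArg (fun x : μ.cells => x.1.1) (T.entry_injective h)
    exact h1.ne this
  omega

/-- Two cells of one diagonal are corners of a rectangle whose other two corners carry distinct
entries in between. This excludes the factors `cc` and `cdc` from words of tableaux. -/
theorem entry_add_three_le_of_diagonal_eq {c d : μ.cells} (h : diagonal μ c = diagonal μ d)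
    (hlt : T.entry c < T.entry d) : T.entry c + 3 ≤ T.entry d := by
  have hc := row_le_sup c
  have hd := row_le_sup d
  unfold diagonal at h
  rcases lt_trichotomy c.1.1 d.1.1 with h1 | h1 | h1
  · exact T.entry_add_three_le h1 (by omega)
  · exact absurd (T.entry_le_of_le (c := d) (d := c) h1.ge (by omega)) (by omega)
  · exact absurd (T.entry_le_of_le (c := d) (d := c) h1.le (by omega)) (by omega)

/-- The next entry cannot be both strictly lower and strictly to the right, since the entries would
differ by 3. If it is not lower, it must be strictly to the right. -/
theorem row_lt_iff_diagonal_lt {c d : μ.cells} (h : T.entry d = T.entry c + 1) :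
    c.1.1 < d.1.1 ↔ diagonal μ d < diagonal μ c := by
  have hc := row_le_sup c
  have hd := row_le_sup d
  unfold diagonal
  rcases lt_or_ge c.1.1 d.1.1 with h1 | h1
  · have : d.1.2 ≤ c.1.2 := by
      by_contra h2
      have := T.entry_add_three_le h1 (not_le.1 h2)
      omega
    omega
  · have : c.1.2 < d.1.2 := by
      by_contra h2
      have := T.entry_le_of_le (c := d) (d := c) h1 (not_lt.1 h2)
      omega
    omega

/-- The cell with entry `j + 1`. -/
def cell (j : Fin μ.card) : μ.cells := (T.exists_entry (Nat.succ_pos j) j.2).choose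

theorem entry_cell (j : Fin μ.card) : T.entry (T.cell j) = j + 1 :=
  (T.exists_entry (Nat.succ_pos j) j.2).choose_spec

theorem cell_eq {c : μ.cells} {j : Fin μ.card} (h : T.entry c = j + 1) : T.cell j = c :=
  T.entry_injective (by rw [entry_cell, h])

/-- The word of the diagonals of the cells with entries `1, 2, …, |μ|`. -/
def word : List ℕ := List.ofFn fun j => diagonal μ (T.cell j)

@[simp] theorem length_word : T.word.length = μ.card := by simp [word]

theorem mem_des_iff {j : ℕ} (hj : j + 1 < μ.card) : j + 1 ∈ T.des ↔
    diagonal μ (T.cell ⟨j + 1, hj⟩) < diagonal μ (T.cell ⟨j, Nat.lt_of_succ_lt hj⟩) := by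
  have e1 := T.entry_cell ⟨j, Nat.lt_of_succ_lt hj⟩
  have e2 := T.entry_cell ⟨j + 1, hj⟩
  rw [← T.row_lt_iff_diagonal_lt (e2.trans (congrArg (· + 1) e1).symm), des, Finset.mem_filter,
    Finset.mem_Ico]
  constructor
  · rintro ⟨-, c, d, hc, hd, h⟩
    rwa [T.cell_eq (j := ⟨j, _⟩) hc, T.cell_eq (j := ⟨j + 1, hj⟩) hd]
  · intro h
    exact ⟨⟨by omega, hj⟩, _, _, e1, e2, h⟩

theorem diagonal_cell_ne {j : ℕ} (hj : j + 1 < μ.card) :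
    diagonal μ (T.cell ⟨j, Nat.lt_of_succ_lt hj⟩) ≠ diagonal μ (T.cell ⟨j + 1, hj⟩) := by
  intro h
  have e1 := T.entry_cell ⟨j, Nat.lt_of_succ_lt hj⟩
  have e2 := T.entry_cell ⟨j + 1, hj⟩
  have := T.entry_add_three_le_of_diagonal_eq h (by rw [e1, e2]; simp)
  rw [e1, e2] at this
  simp at this

theorem word_eq_iff {w : List ℕ} : T.word = w ↔
    w.length = μ.card ∧ ∀ c, w[T.entry c - 1]? = some (diagonal μ c) := by
  constructor
  · rintro rfl
    refine ⟨T.length_word, fun c => ?_⟩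
    have h1 := T.entry_pos c
    have h2 := T.entry_le c
    rw [List.getElem?_eq_getElem (by rw [T.length_word]; omega)]
    simp only [word, List.getElem_ofFn]
    rw [T.cell_eq]
    simp only
    omega
  · rintro ⟨hl, hw⟩
    refine List.ext_getElem (by rw [T.length_word, hl]) fun i h1 h2 => ?_
    have := hw (T.cell ⟨i, by rwa [hl] at h2⟩)
    rw [entry_cell] at this
    simp only [Nat.add_sub_cancel] at this
    rw [List.getElem?_eq_getElem h2] at this
    simp only [word, List.getElem_ofFn]
    exact (Option.some.inj this).symm

/-- Exchange of the entries `m` and `m + 1`, when they are neither in the same row nor in the same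
column. -/
def swapEntries (m : ℕ) (hm : 1 ≤ m) (hm' : m + 1 ≤ μ.card)
    (H : ∀ c d, T.entry c = m → T.entry d = m + 1 → c.1.1 ≠ d.1.1 ∧ c.1.2 ≠ d.1.2) :
    StandardTableau μ where
  entry c := Equiv.swap m (m + 1) (T.entry c)
  bijOn := by
    refine Set.BijOn.comp (t := Set.Icc 1 μ.card) ?_ T.bijOn
    refine ⟨fun k hk => ?_, (Equiv.injective _).injOn, fun k hk => ⟨Equiv.swap m (m + 1) k, ?_,
      Equiv.swap_apply_self _ _ _⟩⟩ <;>
    · rw [Set.mem_Icc] at hk ⊢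
      rw [Equiv.swap_apply_def]
      split_ifs <;> omega
  row_lt c d h h' := by
    have h1 := T.row_lt c d h h'
    have h2 : ¬ (T.entry c = m ∧ T.entry d = m + 1) := fun h2 => (H c d h2.1 h2.2).1 h
    rw [Equiv.swap_apply_def, Equiv.swap_apply_def]
    split_ifs <;> omega
  col_lt c d h h' := by
    have h1 := T.col_lt c d h h'
    have h2 : ¬ (T.entry c = m ∧ T.entry d = m + 1) := fun h2 => (H c d h2.1 h2.2).2 h
    rw [Equiv.swap_apply_def, Equiv.swap_apply_def]
    split_ifs <;> omega

theorem exists_entry_of_word {w : List ℕ} (hw : T.word = w) {i c : ℕ} (hi : w[i]? = some c) :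
    ∃ x, T.entry x = i + 1 ∧ diagonal μ x = c := by
  obtain ⟨hl, hw⟩ := T.word_eq_iff.1 hw
  have hlt : i < w.length := (List.getElem?_eq_some_iff.1 hi).1
  refine ⟨T.cell ⟨i, hl ▸ hlt⟩, T.entry_cell _, ?_⟩
  have := hw (T.cell ⟨i, hl ▸ hlt⟩)
  rw [entry_cell] at this
  simp only [Nat.add_sub_cancel] at this
  rw [hi] at this
  exact (Option.some.inj this).symm

theorem ne_of_word {i k c : ℕ} (h1 : T.word[i]? = some c) (hik : i < k) (hk : k ≤ i + 2) :
    T.word[k]? ≠ some c := by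
  intro h2
  obtain ⟨x, hx, hx'⟩ := T.exists_entry_of_word rfl h1
  obtain ⟨y, hy, hy'⟩ := T.exists_entry_of_word rfl h2
  have := T.entry_add_three_le_of_diagonal_eq (hx'.trans hy'.symm) (by omega)
  omega

/-- A cell between the two would need an entry between consecutive integers, so the cells are
adjacent. Used contrapositively: entries on distant diagonals may be exchanged. -/
theorem same_line_diagonal {x y : μ.cells} (h : T.entry y = T.entry x + 1)
    (hxy : x.1.1 = y.1.1 ∨ x.1.2 = y.1.2) :
    diagonal μ y ≤ diagonal μ x + 1 ∧ diagonal μ x ≤ diagonal μ y + 1 := by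
  have hx := row_le_sup x
  have hy := row_le_sup y
  rcases hxy with e | e
  · have h1 : x.1.2 < y.1.2 := by
      by_contra h1
      have := T.entry_le_of_le (c := y) (d := x) e.ge (not_lt.1 h1)
      omega
    have h2 : y.1.2 ≤ x.1.2 + 1 := by
      by_contra h2
      have he : (x.1.1, x.1.2 + 1) ∈ μ.cells :=
        μ.isLowerSet (a := y.1) (Prod.mk_le_mk.2 ⟨e.le, (not_le.1 h2).le⟩) y.2
      have a1 := T.row_lt x ⟨_, he⟩ rfl (Nat.lt_succ_self _)
      have a2 := T.row_lt ⟨_, he⟩ y e (not_le.1 h2)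
      omega
    unfold diagonal
    omega
  · have h1 : x.1.1 < y.1.1 := by
      by_contra h1
      have := T.entry_le_of_le (c := y) (d := x) (not_lt.1 h1) e.ge
      omega
    have h2 : y.1.1 ≤ x.1.1 + 1 := by
      by_contra h2
      have he : (x.1.1 + 1, x.1.2) ∈ μ.cells :=
        μ.isLowerSet (a := y.1) (Prod.mk_le_mk.2 ⟨(not_le.1 h2).le, e.le⟩) y.2
      have a1 := T.col_lt x ⟨_, he⟩ rfl (Nat.lt_succ_self _)
      have a2 := T.col_lt ⟨_, he⟩ y e (not_le.1 h2)
      omega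
    unfold diagonal
    omega

/-- Two consecutive letters that differ by at least `2` can be exchanged in the word of a
tableau. -/
theorem exists_swap_of_word {a b : List ℕ} {c d : ℕ} (hcd : c + 2 ≤ d ∨ d + 2 ≤ c)
    (hT : T.word = a ++ [c, d] ++ b) : ∃ T' : StandardTableau μ,
      T'.word = a ++ [d, c] ++ b ∧
        T'.entry = fun x => Equiv.swap (a.length + 1) (a.length + 2) (T.entry x) := by
  obtain ⟨hl, hw⟩ := T.word_eq_iff.1 hT
  obtain ⟨x, hx, hxc⟩ := T.exists_entry_of_word (i := a.length) (c := c) hT (by simp)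
  obtain ⟨y, hy, hyd⟩ := T.exists_entry_of_word (i := a.length + 1) (c := d) hT (by simp)
  have hlen : a.length + 1 + 1 ≤ μ.card := by
    rw [← hl]; simp
  refine ⟨T.swapEntries (a.length + 1) (by omega) hlen ?_, ?_, rfl⟩
  · intro x' y' hx' hy'
    obtain rfl := T.entry_injective (hx'.trans hx.symm)
    obtain rfl := T.entry_injective (hy'.trans hy.symm)
    by_contra hne
    have := T.same_line_diagonal (x := x') (y := y') (by omega) (by tauto)
    omega
  · rw [word_eq_iff]
    refine ⟨by rw [← hl]; simp, fun z => ?_⟩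
    have hz := hw z
    have hpos := T.entry_pos z
    change (a ++ [d, c] ++ b)[Equiv.swap (a.length + 1) (a.length + 1 + 1) (T.entry z) - 1]? = _
    rw [Equiv.swap_apply_def]
    split_ifs with h1 h2
    · rw [h1] at hz
      simpa using hz
    · rw [h2] at hz
      simpa using hz
    · rw [← hz]
      rcases lt_or_ge (T.entry z - 1) a.length with h | h
      · rw [List.append_assoc, List.append_assoc, List.getElem?_append_left h,
          List.getElem?_append_left h]
      · rw [List.getElem?_append_right (by simp; omega), List.getElem?_append_right (by simp; omega)]
        simp

end StandardTableau

open Classical in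
/-- The number of standard tableaux of shape `μ` with a given word, in the ring `A`. -/
def wordCount (A : Type*) [CommRing A] (μ : YoungDiagram) : wordFunctional A :=
  ⟨fun w => ∑ T : StandardTableau μ, if T.word = w then 1 else 0, by
    refine ⟨fun a b c => ?_, fun a b c d => ?_, fun a b c d h => ?_⟩
    · refine Finset.sum_eq_zero fun T _ => if_neg fun hT => ?_
      exact T.ne_of_word (i := a.length) (k := a.length + 1) (c := c) (by rw [hT]; simp)
        (by omega) (by omega) (by rw [hT]; simp)
    · refine Finset.sum_eq_zero fun T _ => if_neg fun hT => ?_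
      exact T.ne_of_word (i := a.length) (k := a.length + 2) (c := c) (by rw [hT]; simp)
        (by omega) (by omega) (by rw [hT]; simp)
    · simp only [Finset.sum_boole]
      congr 1
      -- The exchange exists only for tableaux with the prescribed word, so it enters as a relation,
      -- injective in each direction.
      refine le_antisymm (Finset.card_le_card_of_forall_subsingleton
        (fun T T' => T'.entry = fun x => Equiv.swap (a.length + 1) (a.length + 2) (T.entry x))
        ?_ ?_) (Finset.card_le_card_of_forall_subsingleton
        (fun T T' => T'.entry = fun x => Equiv.swap (a.length + 1) (a.length + 2) (T.entry x))
        ?_ ?_)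
      · intro T hT
        obtain ⟨T', h1, h2⟩ := T.exists_swap_of_word (Or.inl h) (Finset.mem_filter.1 hT).2
        exact ⟨T', by simpa using h1, h2⟩
      · rintro T' - T₁ ⟨-, h1⟩ T₂ ⟨-, h2⟩
        refine StandardTableau.ext_entry (funext fun x => ?_)
        exact (Equiv.injective _) (congrFun (h1.symm.trans h2) x)
      · intro T hT
        obtain ⟨T', h1, h2⟩ := T.exists_swap_of_word (Or.inr h) (Finset.mem_filter.1 hT).2
        exact ⟨T', by simpa using h1, h2⟩
      · rintro T' - T₁ ⟨-, h1⟩ T₂ ⟨-, h2⟩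
        refine StandardTableau.ext_entry (funext fun x => ?_)
        exact (Equiv.injective _) (congrFun (h1.symm.trans h2) x)⟩

/-! ### Sequences compatible with a descent set -/

open Classical in
/-- The descent set of a standard super tableau in terms of the descents `D` of the underlying
standard tableau and the signs `ε` of the letters. -/
def superDes (n : ℕ) (D : Finset ℕ) (ε : Fin n → Bool) : Finset ℕ :=
  (Finset.Ico 1 n).filter fun i => ∃ j, ∃ hj : j + 1 < n, j + 1 = i ∧
    ((j + 1 ∈ D ∧ ε ⟨j + 1, hj⟩ = false) ∨ (j + 1 ∉ D ∧ ε ⟨j, Nat.lt_of_succ_lt hj⟩ = true))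

theorem mem_superDes {n : ℕ} {D : Finset ℕ} {ε : Fin n → Bool} {j : ℕ} (hj : j + 1 < n) :
    j + 1 ∈ superDes n D ε ↔ ((j + 1 ∈ D ∧ ε ⟨j + 1, hj⟩ = false) ∨
      (j + 1 ∉ D ∧ ε ⟨j, Nat.lt_of_succ_lt hj⟩ = true)) := by
  classical
  rw [superDes, Finset.mem_filter, Finset.mem_Ico]
  constructor
  · rintro ⟨-, i, hi, e, h⟩
    obtain rfl : i = j := by omega
    exact h
  · exact fun h => ⟨⟨by omega, hj⟩, j, hj, rfl, h⟩

/-- The number of negative signs. -/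
def negCount {n : ℕ} (ε : Fin n → Bool) : ℕ := (Finset.univ.filter fun j => ε j = true).card

/-- `u` is weakly monotone with respect to the strict order `ρ`, and strictly so at the positions
in `D`. -/
def Compatible (ρ : ℕ → ℕ → Prop) {n : ℕ} (D : Finset ℕ) (u : Fin n → ℕ) : Prop :=
  ∀ (j : ℕ) (hj : j + 1 < n), ρ (u ⟨j, Nat.lt_of_succ_lt hj⟩) (u ⟨j + 1, hj⟩) ∨
    (u ⟨j, Nat.lt_of_succ_lt hj⟩ = u ⟨j + 1, hj⟩ ∧ j + 1 ∉ D)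

/-! ### Expansion of products of generating functions -/

/-- The strict order on triples (block, sign, diagonal) in which blocks are ordered by `ρ`, positive
letters precede negative ones, and the diagonals increase on positive letters and decrease on
negative ones. -/
def BlockLT (ρ : ℕ → ℕ → Prop) (p p' : ℕ × Bool × ℕ) : Prop :=
  ρ p.1 p'.1 ∨ (p.1 = p'.1 ∧ ((p.2.1 = false ∧ p'.2.1 = true) ∨
    (p.2.1 = false ∧ p'.2.1 = false ∧ p.2.2 < p'.2.2) ∨
    (p.2.1 = true ∧ p'.2.1 = true ∧ p'.2.2 < p.2.2)))

section BlockLT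

variable {ρ : ℕ → ℕ → Prop}

theorem BlockLT.trans (hρ : ∀ a b c, ρ a b → ρ b c → ρ a c) {p p' p'' : ℕ × Bool × ℕ}
    (h : BlockLT ρ p p') (h' : BlockLT ρ p' p'') : BlockLT ρ p p'' := by
  obtain ⟨a, x, c⟩ := p
  obtain ⟨a', x', c'⟩ := p'
  obtain ⟨a'', x'', c''⟩ := p''
  unfold BlockLT at *
  simp only at *
  rcases h with h | ⟨rfl, h⟩
  · rcases h' with h' | ⟨rfl, h'⟩
    · exact Or.inl (hρ _ _ _ h h')
    · exact Or.inl h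
  · rcases h' with h' | ⟨rfl, h'⟩
    · exact Or.inl h'
    · refine Or.inr ⟨rfl, ?_⟩
      cases x <;> cases x' <;> cases x'' <;> (simp at h h' ⊢; try omega)

theorem BlockLT.irrefl (hρ : ∀ a, ¬ ρ a a) (p : ℕ × Bool × ℕ) : ¬ BlockLT ρ p p := by
  rintro (h | ⟨-, h | h | h⟩)
  · exact hρ _ h
  · simp [h.1] at h
  · exact lt_irrefl _ h.2.2
  · exact lt_irrefl _ h.2.2

/-- This explains the shape of the super descent set: within a block, positive-then-negative is
always allowed, negative-then-positive never, and equal signs are decided by the descent. -/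
theorem blockLT_iff {n : ℕ} {D : Finset ℕ} {ε : Fin n → Bool} {u w : Fin n → ℕ} {j : ℕ}
    (hj : j + 1 < n) (hD : j + 1 ∈ D ↔ w ⟨j + 1, hj⟩ < w ⟨j, Nat.lt_of_succ_lt hj⟩)
    (hne : w ⟨j, Nat.lt_of_succ_lt hj⟩ ≠ w ⟨j + 1, hj⟩) :
    BlockLT ρ (u ⟨j, Nat.lt_of_succ_lt hj⟩, ε ⟨j, Nat.lt_of_succ_lt hj⟩,
        w ⟨j, Nat.lt_of_succ_lt hj⟩) (u ⟨j + 1, hj⟩, ε ⟨j + 1, hj⟩, w ⟨j + 1, hj⟩) ↔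
      ρ (u ⟨j, Nat.lt_of_succ_lt hj⟩) (u ⟨j + 1, hj⟩) ∨
        (u ⟨j, Nat.lt_of_succ_lt hj⟩ = u ⟨j + 1, hj⟩ ∧ j + 1 ∉ superDes n D ε) := by
  rw [mem_superDes hj, hD, BlockLT]
  simp only
  refine or_congr Iff.rfl (and_congr Iff.rfl ?_)
  cases ε ⟨j, Nat.lt_of_succ_lt hj⟩ <;> cases ε ⟨j + 1, hj⟩ <;> (simp; try omega)

/-- The triples with block in `bl` and diagonal less than `M`, in their order. -/
def blockList (bl : List ℕ) (M : ℕ) : List (ℕ × Bool × ℕ) :=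
  bl.flatMap fun i => ((List.range M).map fun c => (i, false, c)) ++
    ((List.range M).reverse.map fun c => (i, true, c))

theorem mem_blockList {bl : List ℕ} {M : ℕ} {p : ℕ × Bool × ℕ} :
    p ∈ blockList bl M ↔ p.1 ∈ bl ∧ p.2.2 < M := by
  obtain ⟨i, x, c⟩ := p
  cases x <;> simp [blockList]

theorem pairwise_blockList {bl : List ℕ} (hbl : bl.Pairwise ρ) (M : ℕ) :
    (blockList bl M).Pairwise (BlockLT ρ) := by
  rw [blockList, List.pairwise_flatMap]
  refine ⟨fun i _ => ?_, hbl.imp fun {i i'} h => ?_⟩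
  · rw [List.pairwise_append, List.pairwise_map, List.pairwise_map, List.pairwise_reverse]
    refine ⟨List.pairwise_lt_range.imp fun h => ?_, List.pairwise_lt_range.imp fun h => ?_, ?_⟩
    · exact Or.inr ⟨rfl, Or.inr (Or.inl ⟨rfl, rfl, h⟩)⟩
    · exact Or.inr ⟨rfl, Or.inr (Or.inr ⟨rfl, rfl, h⟩)⟩
    · intro p hp p' hp'
      obtain ⟨c, -, rfl⟩ := List.mem_map.1 hp
      obtain ⟨c', -, rfl⟩ := List.mem_map.1 hp'
      exact Or.inr ⟨rfl, Or.inl ⟨rfl, rfl⟩⟩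
  · intro p hp p' hp'
    have e : p.1 = i := by
      rcases List.mem_append.1 hp with hp | hp <;> obtain ⟨c, -, rfl⟩ := List.mem_map.1 hp <;> rfl
    have e' : p'.1 = i' := by
      rcases List.mem_append.1 hp' with hp | hp <;> obtain ⟨c, -, rfl⟩ := List.mem_map.1 hp <;> rfl
    exact Or.inl (by rw [e, e']; exact h)

theorem nodup_of_pairwise_blockLT (hρ : ∀ a, ¬ ρ a a) {l : List (ℕ × Bool × ℕ)}
    (hl : l.Pairwise (BlockLT ρ)) : l.Nodup := by
  refine List.Pairwise.imp (fun {a b} h => ?_) hl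
  rintro rfl
  exact BlockLT.irrefl hρ a h

theorem sublist_of_pairwise_blockLT (hρ : ∀ a b c, ρ a b → ρ b c → ρ a c) (hρ' : ∀ a, ¬ ρ a a)
    {s l : List (ℕ × Bool × ℕ)} (hs : s.Pairwise (BlockLT ρ)) (hl : l.Pairwise (BlockLT ρ))
    (h : s ⊆ l) : s.Sublist l := by
  have : Std.Antisymm (BlockLT ρ) :=
    ⟨fun a b h1 h2 => absurd (h1.trans hρ h2) (BlockLT.irrefl hρ' a)⟩
  exact List.sublist_of_subperm_of_pairwise ((nodup_of_pairwise_blockLT hρ' hs).subperm h) hs hl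

theorem pairwise_ofFn_iff (hρ : ∀ a b c, ρ a b → ρ b c → ρ a c) {n : ℕ}
    (f : Fin n → ℕ × Bool × ℕ) : (List.ofFn f).Pairwise (BlockLT ρ) ↔
      ∀ (j : ℕ) (hj : j + 1 < n), BlockLT ρ (f ⟨j, Nat.lt_of_succ_lt hj⟩) (f ⟨j + 1, hj⟩) := by
  have : Trans (BlockLT ρ) (BlockLT ρ) (BlockLT ρ) := ⟨fun h h' => h.trans hρ h'⟩
  rw [← List.isChain_iff_pairwise, List.isChain_iff_getElem]
  simp

end BlockLT

/-- The principal specialization of the letter of a triple (block, sign, diagonal). -/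
def blockValue (p : ℕ × Bool × ℕ) : QT := (if p.2.1 then t else 1) * q ^ p.1

theorem prod_blockValue {n : ℕ} (ε : Fin n → Bool) (u w : Fin n → ℕ) :
    ((List.ofFn fun j => (u j, ε j, w j)).map blockValue).prod =
      t ^ negCount ε * q ^ ∑ j, u j := by
  rw [List.map_ofFn, List.prod_ofFn]
  simp only [Function.comp_def, blockValue]
  rw [Finset.prod_mul_distrib, Finset.prod_pow_eq_pow_sum, ← Finset.prod_filter,
    Finset.prod_const]
  rfl

theorem prod_blockList (U : ℕ → Module.End QT (wordFunctional QT)) (bl : List ℕ) (M : ℕ) :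
    ((blockList bl M).map fun p => 1 + blockValue p • U p.2.2).prod =
      (bl.map fun i => incProd U M (q ^ i) * decProd U M (t * q ^ i)).prod := by
  induction bl with
  | nil => simp [blockList]
  | cons i bl ih =>
    rw [List.map_cons, List.prod_cons, ← ih, blockList, List.flatMap_cons, List.map_append,
      List.prod_append, List.map_append, List.prod_append, List.map_map, List.map_map]
    simp [blockList, incProd, decProd, blockValue, Function.comp_def]

-- The order on triples is strict and the block list is sorted, so its sublists are exactly the
-- chains in it. The word of `T` fixes the diagonals of a chain, leaving only blocks and signs free.
open Classical in
theorem sum_sublists_blockList {μ : YoungDiagram} (T : StandardTableau μ) {ρ : ℕ → ℕ → Prop}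
    (hρ : ∀ a b c, ρ a b → ρ b c → ρ a c) (hρ' : ∀ a, ¬ ρ a a) {bl : List ℕ}
    (hbl : bl.Pairwise ρ) :
    ((blockList bl (diagonalBound μ)).sublists'.map fun s =>
      (s.map blockValue).prod * if T.word = s.map (fun p => p.2.2) then 1 else 0).sum =
    ∑ u ∈ Fintype.piFinset (fun _ : Fin μ.card => bl.toFinset), ∑ ε : Fin μ.card → Bool,
      if Compatible ρ (superDes μ.card T.des ε) u then t ^ negCount ε * q ^ ∑ j, u j else 0 := by
  have hpw := pairwise_blockList hbl (diagonalBound μ)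
  have hnd : (blockList bl (diagonalBound μ)).sublists'.Nodup :=
    List.nodup_sublists'.2 (nodup_of_pairwise_blockLT hρ' hpw)
  rw [← List.sum_toFinset _ hnd, ← Finset.sum_product']
  simp only [mul_ite, mul_one, mul_zero]
  rw [← Finset.sum_filter, ← Finset.sum_filter]
  symm
  have hcompat : ∀ (u : Fin μ.card → ℕ) (ε : Fin μ.card → Bool),
      Compatible ρ (superDes μ.card T.des ε) u ↔
        (List.ofFn fun j => (u j, ε j, diagonal μ (T.cell j))).Pairwise (BlockLT ρ) := by
    intro u ε
    rw [pairwise_ofFn_iff hρ]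
    refine forall_congr' fun j => forall_congr' fun hj => ?_
    exact (blockLT_iff (w := fun j => diagonal μ (T.cell j)) hj (T.mem_des_iff hj)
      (T.diagonal_cell_ne hj)).symm
  refine Finset.sum_bij
    (fun p _ => List.ofFn fun j => (p.1 j, p.2 j, diagonal μ (T.cell j))) ?_ ?_ ?_ ?_
  · rintro ⟨u, ε⟩ hp
    simp only [Finset.mem_filter, Finset.mem_product, Fintype.mem_piFinset, List.mem_toFinset,
      Finset.mem_univ, and_true, List.mem_sublists'] at hp ⊢
    refine ⟨sublist_of_pairwise_blockLT hρ hρ' ((hcompat u ε).1 hp.2) hpw fun p hp' => ?_, ?_⟩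
    · obtain ⟨j, rfl⟩ := (List.mem_ofFn' _ _).1 hp'
      exact mem_blockList.2 ⟨hp.1 j, diagonal_lt_bound _⟩
    · rw [List.map_ofFn]
      rfl
  · rintro ⟨u, ε⟩ - ⟨u', ε'⟩ - h
    have h := List.ofFn_injective h
    refine Prod.ext (funext fun j => ?_) (funext fun j => ?_)
    · exact congrArg Prod.fst (congrFun h j)
    · exact congrArg (fun p => p.2.1) (congrFun h j)
  · intro s hs
    simp only [Finset.mem_filter, List.mem_toFinset, List.mem_sublists'] at hs
    obtain ⟨hs, hw⟩ := hs
    have hlen : s.length = μ.card := by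
      rw [← T.length_word, hw, List.length_map]
    have e : (List.ofFn fun j : Fin μ.card => ((s.get (j.cast hlen.symm)).1,
        (s.get (j.cast hlen.symm)).2.1, diagonal μ (T.cell j))) = s := by
      refine List.ext_getElem (by simp [hlen]) fun i h1 h2 => ?_
      rw [List.getElem_ofFn]
      refine Prod.ext rfl (Prod.ext rfl ?_)
      have h3 : T.word[i]'(by rw [T.length_word, ← hlen]; exact h2) =
          (s.map fun p => p.2.2)[i]'(by simpa using h2) := by simp only [hw]
      simpa [StandardTableau.word] using h3
    refine ⟨(fun j => (s.get (j.cast hlen.symm)).1, fun j => (s.get (j.cast hlen.symm)).2.1),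
      ?_, e⟩
    simp only [Finset.mem_filter, Finset.mem_product, Fintype.mem_piFinset, List.mem_toFinset,
      Finset.mem_univ, and_true]
    refine ⟨fun j => (mem_blockList.1 (hs.subset (List.get_mem _ _))).1, ?_⟩
    rw [hcompat, e]
    exact hpw.sublist hs
  · rintro ⟨u, ε⟩ -
    exact (prod_blockValue ε u _).symm

open Classical in
theorem superProd_apply_wordCount (μ : YoungDiagram) {ρ : ℕ → ℕ → Prop}
    (hρ : ∀ a b c, ρ a b → ρ b c → ρ a c) (hρ' : ∀ a, ¬ ρ a a) {bl : List ℕ}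
    (hbl : bl.Pairwise ρ) :
    ((bl.map fun i => incProd (appendOp QT) (diagonalBound μ) (q ^ i) *
      decProd (appendOp QT) (diagonalBound μ) (t * q ^ i)).prod (wordCount QT μ)).1 [] =
    ∑ u ∈ Fintype.piFinset (fun _ : Fin μ.card => bl.toFinset),
      ∑ T : StandardTableau μ, ∑ ε : Fin μ.card → Bool,
        if Compatible ρ (superDes μ.card T.des ε) u then t ^ negCount ε * q ^ ∑ j, u j else 0 := by
  rw [← prod_blockList, prod_one_add_appendOp_apply blockValue (fun p => p.2.2), Finset.sum_comm]
  simp only [← sum_sublists_blockList _ hρ hρ' hbl]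
  rw [← Multiset.sum_coe]
  simp only [wordCount, List.nil_append, Finset.mul_sum]
  simp only [← Multiset.sum_coe, ← Multiset.map_coe]
  exact Multiset.sum_map_sum_map _ _

/-! ### Symmetry under reversal of the blocks -/

open Classical in
theorem sum_compatible_lt_eq_gt (μ : YoungDiagram) (m : ℕ) :
    (∑ u ∈ Fintype.piFinset (fun _ : Fin μ.card => Finset.range m),
      ∑ T : StandardTableau μ, ∑ ε : Fin μ.card → Bool,
        if Compatible (· < ·) (superDes μ.card T.des ε) u
          then t ^ negCount ε * q ^ ∑ j, u j else 0) =
    ∑ u ∈ Fintype.piFinset (fun _ : Fin μ.card => Finset.range m),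
      ∑ T : StandardTableau μ, ∑ ε : Fin μ.card → Bool,
        if Compatible (· > ·) (superDes μ.card T.des ε) u
          then t ^ negCount ε * q ^ ∑ j, u j else 0 := by
  have h1 := superProd_apply_wordCount μ (ρ := (· < ·)) (fun _ _ _ => lt_trans) lt_irrefl
    (List.pairwise_lt_range (n := m))
  have h2 := superProd_apply_wordCount μ (ρ := (· > ·)) (fun _ _ _ h h' => lt_trans h' h)
    lt_irrefl (List.pairwise_reverse.2 (List.pairwise_lt_range (n := m)))
  rw [List.toFinset_reverse] at h2
  rw [List.toFinset_range] at h1 h2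
  rw [← h1, ← h2]
  rw [List.Perm.prod_eq' ((List.reverse_perm (List.range m)).symm.map _)]
  rw [List.pairwise_map]
  exact List.pairwise_of_forall fun i j =>
    isNilTemperleyLieb_appendOp.superProd_comm _ _ _ _ _

/-! ### Generating functions of compatible sequences -/

open Classical in
theorem summable_q_pow {ι : Type*} (d : ι → ℕ) (p : ι → Prop)
    (hd : ∀ k, {i | d i = k}.Finite) : Summable fun i => if p i then q ^ d i else (0 : QT) := by
  rw [MvPowerSeries.WithPiTopology.summable_iff_summable_coeff]
  intro e
  refine summable_of_hasFiniteSupport ((hd (e 0)).subset fun i hi => ?_)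
  rw [Function.mem_support] at hi
  by_contra hne
  refine hi ?_
  split_ifs
  · rw [q, MvPowerSeries.coeff_X_pow, if_neg]
    rintro rfl
    simp at hne
  · simp

theorem hasSum_geometric_q (n : ℕ) :
    ∃ g : QT, HasSum (fun k : ℕ => (q ^ (n + 1)) ^ k) g ∧ (1 - q * q ^ n) * g = 1 := by
  have h0 : MvPowerSeries.constantCoeff (q ^ (n + 1) : QT) = 0 := by simp [q]
  have hs := MvPowerSeries.WithPiTopology.summable_pow_of_constantCoeff_eq_zero h0
  refine ⟨_, hs.hasSum, ?_⟩
  rw [← pow_succ']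
  exact hs.one_sub_mul_tsum_pow

theorem coe_pochhammerUnit_succ (n : ℕ) :
    (pochhammerUnit (n + 1) : QT) = pochhammerUnit n * (1 - q * q ^ n) :=
  Finset.prod_range_succ _ _

section Cons

variable {n : ℕ} (D : Finset ℕ)

/-- The shift of a descent set when the first term of a sequence is removed. -/
def shiftDes : Finset ℕ := D.preimage Nat.succ Nat.succ_injective.injOn

/-- The sequence with first term `k` and the other terms raised accordingly. -/
def consShift (p : ℕ × (Fin n → ℕ)) : Fin (n + 1) → ℕ :=
  Fin.cons p.1 fun j => p.2 j + (p.1 + if 1 ∈ D then 1 else 0)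

theorem consShift_injective : Function.Injective (consShift (n := n) D) := by
  rintro ⟨k, r⟩ ⟨k', r'⟩ h
  have h0 := congrFun h 0
  simp only [consShift, Fin.cons_zero] at h0
  subst h0
  refine Prod.ext rfl (funext fun j => ?_)
  have := congrFun h j.succ
  simp only [consShift, Fin.cons_succ] at this
  simp only
  omega

theorem compatible_consShift (p : ℕ × (Fin n → ℕ)) :
    Compatible (· < ·) D (consShift D p) ↔ Compatible (· < ·) (shiftDes D) p.2 := by
  obtain ⟨k, r⟩ := p
  have hs : ∀ (j : ℕ) (hj : j + 1 < n + 1),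
      consShift D (k, r) ⟨j + 1, hj⟩ = r ⟨j, by omega⟩ + (k + if 1 ∈ D then 1 else 0) :=
    fun j hj => rfl
  have h0 : ∀ h, consShift D (k, r) ⟨0, h⟩ = k := fun _ => rfl
  constructor
  · intro h j hj
    have := h (j + 1) (by omega)
    rw [hs, hs] at this
    simp only [shiftDes, Finset.mem_preimage] at this ⊢
    rcases this with h | h
    · exact Or.inl (by omega)
    · exact Or.inr ⟨by omega, h.2⟩
  · rintro h (_ | j) hj
    · rw [hs, h0]
      by_cases h1 : 1 ∈ D
      · rw [if_pos h1]
        exact Or.inl (by omega)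
      · rw [if_neg h1]
        by_cases h2 : r ⟨0, by omega⟩ = 0
        · exact Or.inr ⟨by omega, h1⟩
        · exact Or.inl (by omega)
    · rw [hs, hs]
      have := h j (by omega)
      simp only [shiftDes, Finset.mem_preimage] at this ⊢
      rcases this with h | h
      · exact Or.inl (by omega)
      · exact Or.inr ⟨by omega, h.2⟩

/-- The first term is a minimum, and all later terms exceed it when position 1 is strict, so the
truncated subtraction loses nothing. -/
theorem mem_range_consShift {u : Fin (n + 1) → ℕ} (h : Compatible (· < ·) D u) :
    u ∈ Set.range (consShift (n := n) D) := by
  have key : ∀ (j : ℕ) (hj : j + 1 < n + 1), u 0 + (if 1 ∈ D then 1 else 0) ≤ u ⟨j + 1, hj⟩ := by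
    intro j
    induction j with
    | zero =>
      intro hj
      have := h 0 hj
      simp only [zero_add] at this
      change _ ∨ u 0 = _ ∧ _ at this
      change u 0 < _ ∨ _ at this
      split_ifs with h1
      · have := this.resolve_right fun h => h.2 h1
        simpa using this
      · simp only [zero_add]
        omega
    | succ j ih =>
      intro hj
      have h1 := ih (by omega)
      have h2 := h (j + 1) hj
      simp only at h2
      omega
  refine ⟨(u 0, fun j => u j.succ - (u 0 + if 1 ∈ D then 1 else 0)), ?_⟩
  funext j
  refine Fin.cases rfl (fun j => ?_) j
  simp only [consShift, Fin.cons_succ]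
  have := key j (by omega)
  change _ ≤ u j.succ at this
  omega

theorem sum_consShift (p : ℕ × (Fin n → ℕ)) :
    ∑ j, consShift D p j = (n + 1) * p.1 + ∑ j, p.2 j + if 1 ∈ D then n else 0 := by
  rw [Fin.sum_univ_succ]
  simp only [consShift, Fin.cons_zero, Fin.cons_succ, Finset.sum_add_distrib, Finset.sum_const,
    Finset.card_univ, Fintype.card_fin, smul_eq_mul]
  split_ifs <;> ring

end Cons

-- Removing the first term `k` lowers all `n + 1` terms by `k`, a geometric series in `q ^ (n + 1)`;
-- strictness at position 1 costs one more for each of the other `n` terms. An element `n` of `D` is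
-- harmless, having weight 0.
open Classical in
theorem hasSum_compatible_lt_aux (n : ℕ) (D : Finset ℕ) :
    HasSum (fun u : Fin n → ℕ => if Compatible (· < ·) D u then q ^ ∑ j, u j else 0)
      (((pochhammerUnit n)⁻¹ : QTˣ) *
        q ^ ∑ j ∈ Finset.range n, if j + 1 ∈ D then n - (j + 1) else 0) := by
  induction n generalizing D with
  | zero =>
    have h : (pochhammerUnit 0 : QTˣ) = 1 := Units.ext (by simp [pochhammerUnit, pochhammer])
    have hc : ∀ u : Fin 0 → ℕ, Compatible (· < ·) D u := fun u j hj => absurd hj (by omega)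
    rw [h]
    simp [hc]
  | succ n ih =>
    obtain ⟨g, hg, hg1⟩ := hasSum_geometric_q n
    have hsum : Summable fun p : ℕ × (Fin n → ℕ) => (q ^ (n + 1)) ^ p.1 *
        if Compatible (· < ·) (shiftDes D) p.2 then q ^ ∑ j, p.2 j else (0 : QT) := by
      refine (summable_q_pow (fun p : ℕ × (Fin n → ℕ) => (n + 1) * p.1 + ∑ j, p.2 j)
        (fun p => Compatible (· < ·) (shiftDes D) p.2) fun k => ?_).congr fun p => ?_
      · refine ((Set.finite_Iic k).prod (Set.Finite.pi' fun _ : Fin n =>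
          Set.finite_Iic k)).subset ?_
        rintro ⟨a, r⟩ rfl
        refine ⟨?_, fun j => ?_⟩
        · simp only [Set.mem_Iic]
          nlinarith [Nat.zero_le (∑ j, r j)]
        · have := Finset.single_le_sum (f := r) (fun _ _ => Nat.zero_le _) (Finset.mem_univ j)
          simp only [Set.mem_Iic]
          exact this.trans (Nat.le_add_left _ _)
      · split_ifs
        · rw [pow_add, pow_mul]
        · rw [mul_zero]
    have hprod := (hg.mul (ih (shiftDes D)) hsum).mul_right
      (q ^ (if 1 ∈ D then n else 0) : QT)
    refine ((consShift_injective (n := n) D).hasSum_iff fun u hu => ?_).1 ?_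
    · exact if_neg fun h => hu (mem_range_consShift D h)
    · have e1 : (fun u : Fin (n + 1) → ℕ => if Compatible (· < ·) D u then q ^ ∑ j, u j
          else (0 : QT)) ∘ consShift D = fun p => ((q ^ (n + 1)) ^ p.1 *
            if Compatible (· < ·) (shiftDes D) p.2 then q ^ ∑ j, p.2 j else 0) *
              q ^ (if 1 ∈ D then n else 0) := by
        funext p
        simp only [Function.comp_apply, compatible_consShift, sum_consShift]
        by_cases h : Compatible (· < ·) (shiftDes D) p.2
        · rw [if_pos h, if_pos h, pow_add, pow_add, pow_mul]
        · rw [if_neg h, if_neg h, mul_zero, zero_mul]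
      rw [e1]
      convert! hprod using 1
      rw [Units.inv_mul_eq_iff_eq_mul, coe_pochhammerUnit_succ, Finset.sum_range_succ', pow_add]
      have e : ∀ x y : QT, (pochhammerUnit n : QT) * (1 - q * q ^ n) *
          (g * (((pochhammerUnit n)⁻¹ : QTˣ) * x) * y) =
            ((1 - q * q ^ n) * g) * (pochhammerUnit n * ((pochhammerUnit n)⁻¹ : QTˣ)) *
              (x * y) := fun x y => by ring
      rw [e, hg1, Units.mul_inv, one_mul, one_mul]
      simp [shiftDes]

theorem sum_range_ite_mem {n : ℕ} {D : Finset ℕ} (hD : D ⊆ Finset.Ico 1 n) (f : ℕ → ℕ) :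
    (∑ j ∈ Finset.range n, if j + 1 ∈ D then f (j + 1) else 0) = ∑ i ∈ D, f i := by
  rw [← Finset.sum_filter]
  refine Finset.sum_nbij (· + 1) ?_ ?_ ?_ fun _ _ => rfl
  · intro j hj
    exact (Finset.mem_filter.1 hj).2
  · intro i _ j _ h
    exact Nat.succ_injective h
  · intro i hi
    have := Finset.mem_Ico.1 (hD hi)
    have e : i - 1 + 1 = i := by omega
    refine ⟨i - 1, ?_, e⟩
    simp only [Finset.coe_filter, Finset.mem_range, Set.mem_ofPred_eq, e]
    exact ⟨by omega, hi⟩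

open Classical in
theorem hasSum_compatible_lt {n : ℕ} {D : Finset ℕ} (hD : D ⊆ Finset.Ico 1 n) :
    HasSum (fun u : Fin n → ℕ => if Compatible (· < ·) D u then q ^ ∑ j, u j else 0)
      (((pochhammerUnit n)⁻¹ : QTˣ) * q ^ ∑ i ∈ D, (n - i)) := by
  have := hasSum_compatible_lt_aux n D
  rwa [sum_range_ite_mem hD fun i => n - i] at this

/-- Reading backwards turns decreasing into increasing and moves the strict position `i` to `n - i`,
which exchanges comajor and major index. -/
theorem compatible_rev {n : ℕ} {D : Finset ℕ} (hD : D ⊆ Finset.Ico 1 n) (u : Fin n → ℕ) :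
    Compatible (· < ·) (D.image (n - ·)) (u ∘ Fin.rev) ↔ Compatible (· > ·) D u := by
  have hmem : ∀ i, i + 1 < n → (n - (i + 1) ∈ D.image (n - ·) ↔ i + 1 ∈ D) := by
    intro i hi
    rw [Finset.mem_image]
    constructor
    · rintro ⟨k, hk, e⟩
      have := Finset.mem_Ico.1 (hD hk)
      obtain rfl : k = i + 1 := by omega
      exact hk
    · exact fun h => ⟨_, h, rfl⟩
  have hrev : ∀ (i : ℕ) (hi : i < n) (k : ℕ) (hk : k < n), i + k + 1 = n →
      (u ∘ Fin.rev) ⟨i, hi⟩ = u ⟨k, hk⟩ := by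
    intro i hi k hk e
    refine congrArg u (Fin.ext ?_)
    simp only [Fin.val_rev]
    omega
  constructor
  · intro h j hj
    have := h (n - (j + 2)) (by omega)
    rw [hrev _ _ (j + 1) hj (by omega), hrev _ _ j (by omega) (by omega),
      show n - (j + 2) + 1 = n - (j + 1) by omega, hmem j hj] at this
    exact this.imp_right fun h => ⟨h.1.symm, h.2⟩
  · intro h j hj
    have := h (n - (j + 2)) (by omega)
    rw [← hmem _ (by omega), show n - (n - (j + 2) + 1) = j + 1 by omega] at this
    rw [hrev j (by omega) (n - (j + 2) + 1) (by omega) (by omega),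
      hrev (j + 1) hj (n - (j + 2)) (by omega) (by omega)]
    exact this.imp_right fun h => ⟨h.1.symm, h.2⟩

open Classical in
theorem hasSum_compatible_gt {n : ℕ} {D : Finset ℕ} (hD : D ⊆ Finset.Ico 1 n) :
    HasSum (fun u : Fin n → ℕ => if Compatible (· > ·) D u then q ^ ∑ j, u j else 0)
      (((pochhammerUnit n)⁻¹ : QTˣ) * q ^ ∑ i ∈ D, i) := by
  have hD' : D.image (n - ·) ⊆ Finset.Ico 1 n := by
    intro i hi
    obtain ⟨k, hk, rfl⟩ := Finset.mem_image.1 hi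
    have := Finset.mem_Ico.1 (hD hk)
    rw [Finset.mem_Ico]
    omega
  have h := hasSum_compatible_lt hD'
  have hinj : Set.InjOn (n - ·) (D : Set ℕ) := by
    intro i hi k hk e
    have h1 := Finset.mem_Ico.1 (hD hi)
    have h2 := Finset.mem_Ico.1 (hD hk)
    simp only at e
    omega
  have hsum : ∑ i ∈ D.image (n - ·), (n - i) = ∑ i ∈ D, i := by
    rw [Finset.sum_image hinj]
    refine Finset.sum_congr rfl fun i hi => ?_
    have := Finset.mem_Ico.1 (hD hi)
    omega
  rw [hsum, ← (Equiv.arrowCongr (Fin.revPerm (n := n)) (Equiv.refl ℕ)).hasSum_iff] at h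
  convert h using 1
  funext u
  have hc : Compatible (· < ·) (D.image (n - ·))
      ((Equiv.arrowCongr (Fin.revPerm (n := n)) (Equiv.refl ℕ)) u) ↔ Compatible (· > ·) D u :=
    compatible_rev hD u
  have hs : ∑ j, (Equiv.arrowCongr (Fin.revPerm (n := n)) (Equiv.refl ℕ)) u j = ∑ j, u j :=
    Equiv.sum_comp (Fin.revPerm (n := n)) u
  simp only [Function.comp_apply, hc, hs]

theorem superDes_subset (n : ℕ) (D : Finset ℕ) (ε : Fin n → Bool) :
    superDes n D ε ⊆ Finset.Ico 1 n := by
  classical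
  exact Finset.filter_subset _ _

/-- The generating functions of comajor and major index agree. -/
theorem sum_comaj_eq_sum_maj (μ : YoungDiagram) :
    (((pochhammerUnit μ.card)⁻¹ : QTˣ) : QT) * ∑ T : StandardTableau μ, ∑ ε : Fin μ.card → Bool,
      t ^ negCount ε * q ^ ∑ i ∈ superDes μ.card T.des ε, (μ.card - i) =
    ((pochhammerUnit μ.card)⁻¹ : QTˣ) * ∑ T : StandardTableau μ, ∑ ε : Fin μ.card → Bool,
      t ^ negCount ε * q ^ ∑ i ∈ superDes μ.card T.des ε, i := by
  classical
  -- The boxes exhaust all sequences, so both infinite sums are limits of the truncations already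
  -- known to be equal.
  have hbox : Filter.Tendsto (fun m : ℕ => Fintype.piFinset fun _ : Fin μ.card => Finset.range m)
      Filter.atTop Filter.atTop := by
    refine Filter.tendsto_atTop_finset_of_monotone (fun a b h => ?_) fun u => ?_
    · exact Fintype.piFinset_subset _ _ fun _ => Finset.range_mono h
    · refine ⟨(∑ j, u j) + 1, Fintype.mem_piFinset.2 fun j => Finset.mem_range.2 ?_⟩
      exact Nat.lt_succ_of_le
        (Finset.single_le_sum (f := u) (fun _ _ => Nat.zero_le _) (Finset.mem_univ j))
  have h1 : HasSum (fun u : Fin μ.card → ℕ => ∑ T : StandardTableau μ, ∑ ε : Fin μ.card → Bool,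
      if Compatible (· < ·) (superDes μ.card T.des ε) u
        then t ^ negCount ε * q ^ ∑ j, u j else 0) _ :=
    hasSum_sum fun T _ => hasSum_sum fun ε _ => by
      simpa only [mul_ite, mul_zero] using
        (hasSum_compatible_lt (superDes_subset μ.card T.des ε)).mul_left (t ^ negCount ε)
  have h2 : HasSum (fun u : Fin μ.card → ℕ => ∑ T : StandardTableau μ, ∑ ε : Fin μ.card → Bool,
      if Compatible (· > ·) (superDes μ.card T.des ε) u
        then t ^ negCount ε * q ^ ∑ j, u j else 0) _ :=
    hasSum_sum fun T _ => hasSum_sum fun ε _ => by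
      simpa only [mul_ite, mul_zero] using
        (hasSum_compatible_gt (superDes_subset μ.card T.des ε)).mul_left (t ^ negCount ε)
  have h := tendsto_nhds_unique (h1.comp hbox)
    ((h2.comp hbox).congr fun m => (sum_compatible_lt_eq_gt μ m).symm)
  simp only [Finset.mul_sum]
  simpa only [mul_left_comm] using h

/-! ### Super tableaux as signed tableaux -/

namespace StandardSuperTableau

variable {μ : YoungDiagram} (T : StandardSuperTableau μ)

/-- The signs of the letters of a super tableau, in the order of their absolute values. -/
def signs (j : Fin μ.card) : Bool := (ofLex (T.entry (T.plus.cell j))).2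

theorem ofLex_entry (c : μ.cells) {j : Fin μ.card} (h : T.plus.entry c = j + 1) :
    T.entry c = toLex (⟨T.plus.entry c, T.plus.entry_pos c⟩, T.signs j) := by
  refine ofLex.injective (Prod.ext (PNat.eq rfl) ?_)
  rw [signs, T.plus.cell_eq h]
  rfl

theorem mem_negSet_iff (j : Fin μ.card) : (j : ℕ) + 1 ∈ T.negSet ↔ T.signs j = true := by
  classical
  rw [negSet, Finset.mem_filter, Finset.mem_Icc]
  constructor
  · rintro ⟨-, c, k, hk, hc⟩
    have h1 : T.plus.entry c = j + 1 := by
      rw [← hk]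
      change ((T.entry c).proj : ℕ) = _
      rw [hc]
      rfl
    rw [signs, T.plus.cell_eq h1, hc]
    rfl
  · intro h
    refine ⟨⟨by omega, by omega⟩, T.plus.cell j, ⟨j + 1, Nat.succ_pos _⟩, rfl, ?_⟩
    rw [T.ofLex_entry _ (T.plus.entry_cell j), h]
    exact congrArg (fun k => Letter.bar k) (PNat.eq (T.plus.entry_cell j))

theorem des_eq_superDes : T.des = superDes μ.card T.plus.des T.signs := by
  ext i
  rw [des, Finset.mem_filter]
  constructor
  · rintro ⟨hi, h⟩
    rw [Finset.mem_Ico] at hi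
    obtain ⟨j, rfl⟩ : ∃ j, i = j + 1 := ⟨i - 1, by omega⟩
    rw [mem_superDes hi.2, ← T.mem_negSet_iff, ← Bool.not_eq_true, ← T.mem_negSet_iff]
    exact h
  · intro h
    have hi : i ∈ Finset.Ico 1 μ.card := by
      classical
      exact Finset.mem_of_mem_filter _ h
    refine ⟨hi, ?_⟩
    rw [Finset.mem_Ico] at hi
    obtain ⟨j, rfl⟩ : ∃ j, i = j + 1 := ⟨i - 1, by omega⟩
    rwa [mem_superDes hi.2, ← T.mem_negSet_iff, ← Bool.not_eq_true, ← T.mem_negSet_iff] at h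

theorem neg_eq_negCount : T.neg = negCount T.signs := by
  classical
  symm
  refine Finset.card_bij (fun j _ => (j : ℕ) + 1) ?_ ?_ ?_
  · intro j hj
    exact (T.mem_negSet_iff j).2 (Finset.mem_filter.1 hj).2
  · intro i _ j _ h
    exact Fin.ext (Nat.succ_injective h)
  · intro i hi
    have hi' := Finset.mem_Icc.1 (Finset.mem_of_mem_filter _ hi)
    have e : i - 1 + 1 = i := by omega
    refine ⟨⟨i - 1, by omega⟩, Finset.mem_filter.2 ⟨Finset.mem_univ _, ?_⟩, e⟩
    rw [← T.mem_negSet_iff]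
    simpa only [e] using hi

/-- The entry of the cell `c` in the super tableau given by `T` and the signs `ε`. -/
def signedEntry (T : StandardTableau μ) (ε : Fin μ.card → Bool) (c : μ.cells) : Letter :=
  toLex ((⟨T.entry c, T.entry_pos c⟩ : ℕ+), ε ⟨T.entry c - 1, by
    have := T.entry_pos c
    have := T.entry_le c
    omega⟩)

/-- The super tableau with a given underlying standard tableau and given signs. -/
def ofSigns (T : StandardTableau μ) (ε : Fin μ.card → Bool) : StandardSuperTableau μ where
  entry := signedEntry T ε
  row_lt c d h h' := Prod.Lex.lt_iff.2 (Or.inl (T.row_lt c d h h'))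
  col_lt c d h h' := Prod.Lex.lt_iff.2 (Or.inl (T.col_lt c d h h'))
  exactly_one i hi := by
    obtain ⟨c, hc⟩ := T.exists_entry i.pos hi
    have hi' : (i : ℕ) - 1 < μ.card := by
      have := i.pos
      omega
    have key : ∀ b, (∃ d, signedEntry T ε d = toLex (i, b)) ↔ ε ⟨i - 1, hi'⟩ = b := by
      intro b
      constructor
      · rintro ⟨d, hd⟩
        have hd := toLex.injective hd
        refine Eq.trans ?_ (congrArg Prod.snd hd)
        refine congrArg ε (Fin.ext ?_)
        simp only [← congrArg (fun p => (p.1 : ℕ)) hd]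
        rfl
      · intro h
        refine ⟨c, congrArg toLex (Prod.ext (PNat.eq hc) ?_)⟩
        rw [← h]
        exact congrArg ε (Fin.ext (congrArg (· - 1) hc))
    rw [Letter.pos, Letter.bar, key, key]
    cases ε ⟨i - 1, hi'⟩ <;> simp [Xor]

theorem bijective_plus_signs : Function.Bijective fun T : StandardSuperTableau μ =>
    (T.plus, T.signs) := by
  constructor
  · intro T T' h
    have h1 : T.plus = T'.plus := congrArg Prod.fst h
    have h2 : T.signs = T'.signs := congrArg Prod.snd h
    have : T.entry = T'.entry := by
      funext c
      have hp := T.plus.entry_pos c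
      have hl := T.plus.entry_le c
      rw [T.ofLex_entry c (j := ⟨T.plus.entry c - 1, by omega⟩) (by simp only; omega),
        T'.ofLex_entry c (j := ⟨T.plus.entry c - 1, by omega⟩) (by rw [← h1]; simp only; omega)]
      simp only [h1, h2]
    cases T; cases T'; cases this; rfl
  · rintro ⟨T, ε⟩
    have h1 : (ofSigns T ε).plus = T := StandardTableau.ext_entry rfl
    refine ⟨ofSigns T ε, Prod.ext h1 (funext fun j => ?_)⟩
    have e := (ofSigns T ε).plus.entry_cell j
    change T.entry _ = _ at e
    refine congrArg ε (Fin.ext ?_)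
    simp only [e]
    rfl

theorem sum_eq_sum_signs {M : Type*} [AddCommMonoid M]
    (f : StandardTableau μ → (Fin μ.card → Bool) → M) :
    ∑ T : StandardSuperTableau μ, f T.plus T.signs = ∑ T, ∑ ε, f T ε := by
  rw [← Finset.sum_product', Finset.univ_product_univ]
  exact Fintype.sum_bijective _ bijective_plus_signs _ _ fun _ => rfl

end StandardSuperTableau

/-! ### Specialization of super quasisymmetric functions -/

/-- The sequence of letters with given blocks (numbered from `0`) and signs. -/
def letterSeq {n : ℕ} (ε : Fin n → Bool) (u : Fin n → ℕ) (j : Fin n) : Letter :=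
  toLex (Nat.succPNat (u j), ε j)

theorem letterSeq_injective {n : ℕ} (ε : Fin n → Bool) :
    Function.Injective (letterSeq ε) := by
  intro u u' h
  funext j
  have := congrArg Prod.fst (toLex.injective (congrFun h j))
  exact Nat.succPNat_injective this

theorem mem_range_letterSeq {n : ℕ} {ε : Fin n → Bool} {a : Fin n → Letter}
    (h : (fun j => (ofLex (a j)).2) = ε) : a ∈ Set.range (letterSeq ε) := by
  refine ⟨fun j => ((ofLex (a j)).1 : ℕ+).natPred, funext fun j => ?_⟩
  refine ofLex.injective (Prod.ext (PNat.succPNat_natPred _) ?_)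
  exact (congrFun h j).symm

theorem monotone_iff_le_next {α : Type*} [Preorder α] {n : ℕ} {a : Fin n → α} :
    Monotone a ↔ ∀ (j : ℕ) (hj : j + 1 < n), a ⟨j, Nat.lt_of_succ_lt hj⟩ ≤ a ⟨j + 1, hj⟩ := by
  constructor
  · exact fun h j hj => h (Nat.le_succ j)
  · rintro h ⟨i, hi⟩ ⟨k, hk⟩ hik
    have hik : i ≤ k := hik
    induction k, hik using Nat.le_induction with
    | base => exact le_rfl
    | succ k _ ih => exact (ih (Nat.lt_of_succ_lt hk) ‹_›).trans (h k hk)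

theorem isAdmissible_letterSeq {n : ℕ} (D : Finset ℕ) (ε : Fin n → Bool) (u : Fin n → ℕ) :
    IsAdmissible n D (letterSeq ε u) ↔ Compatible (· < ·) (superDes n D ε) u := by
  rw [IsAdmissible, monotone_iff_le_next, ← forall_and]
  refine forall_congr' fun j => ?_
  rw [← forall_and]
  refine forall_congr' fun hj => ?_
  rw [mem_superDes hj]
  have h1 : letterSeq ε u ⟨j, Nat.lt_of_succ_lt hj⟩ ≤ letterSeq ε u ⟨j + 1, hj⟩ ↔
      u ⟨j, Nat.lt_of_succ_lt hj⟩ < u ⟨j + 1, hj⟩ ∨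
        (u ⟨j, Nat.lt_of_succ_lt hj⟩ = u ⟨j + 1, hj⟩ ∧
          ε ⟨j, Nat.lt_of_succ_lt hj⟩ ≤ ε ⟨j + 1, hj⟩) := by
    rw [letterSeq, letterSeq, Prod.Lex.toLex_le_toLex, Nat.succPNat_lt_succPNat,
      Nat.succPNat_inj]
  have h2 : letterSeq ε u ⟨j, Nat.lt_of_succ_lt hj⟩ = letterSeq ε u ⟨j + 1, hj⟩ ↔
      (u ⟨j, Nat.lt_of_succ_lt hj⟩ = u ⟨j + 1, hj⟩ ∧
          ε ⟨j, Nat.lt_of_succ_lt hj⟩ = ε ⟨j + 1, hj⟩) := by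
    rw [letterSeq, letterSeq, toLex_inj, Prod.mk_inj, Nat.succPNat_inj]
  have h3 : (letterSeq ε u ⟨j, Nat.lt_of_succ_lt hj⟩).IsNeg ↔
      ε ⟨j, Nat.lt_of_succ_lt hj⟩ = true := Iff.rfl
  rw [h1, h2, h3]
  rcases lt_trichotomy (u ⟨j, Nat.lt_of_succ_lt hj⟩) (u ⟨j + 1, hj⟩) with h | h | h
  · simp [h, h.ne]
  · rw [h]
    by_cases hD : j + 1 ∈ D <;> cases ε ⟨j, Nat.lt_of_succ_lt hj⟩ <;> cases ε ⟨j + 1, hj⟩ <;>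
      simp [hD]
  · simp [h.not_gt, h.ne']

theorem prod_principalValue_letterSeq {n : ℕ} (ε : Fin n → Bool) (u : Fin n → ℕ) :
    ∏ j, principalValue (letterSeq ε u j) = t ^ negCount ε * q ^ ∑ j, u j := by
  have h : ∀ j, principalValue (letterSeq ε u j) = (if ε j then t else 1) * q ^ u j :=
    fun _ => rfl
  simp only [h]
  rw [Finset.prod_mul_distrib, Finset.prod_pow_eq_pow_sum, ← Finset.prod_filter,
    Finset.prod_const]
  rfl

-- Sequences are split by their signs; for a fixed `ε`, `letterSeq ε` reduces the sum to one over
-- compatible block sequences.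
open Classical in
theorem hasSum_isAdmissible (n : ℕ) (D : Finset ℕ) :
    HasSum (fun a : Fin n → Letter =>
        if IsAdmissible n D a then ∏ j, principalValue (a j) else 0)
      (∑ ε : Fin n → Bool, t ^ negCount ε *
        (((pochhammerUnit n)⁻¹ : QTˣ) * q ^ ∑ i ∈ superDes n D ε, (n - i))) := by
  have key : ∀ ε : Fin n → Bool, HasSum (fun a : Fin n → Letter =>
      if (fun j => (ofLex (a j)).2) = ε then
        (if IsAdmissible n D a then ∏ j, principalValue (a j) else 0) else 0)
      (t ^ negCount ε *
        (((pochhammerUnit n)⁻¹ : QTˣ) * q ^ ∑ i ∈ superDes n D ε, (n - i))) := by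
    intro ε
    refine ((letterSeq_injective ε).hasSum_iff fun a ha => ?_).1 ?_
    · exact if_neg fun h => ha (mem_range_letterSeq h)
    · have h := (hasSum_compatible_lt (superDes_subset n D ε)).mul_left (t ^ negCount ε)
      have e : (fun a : Fin n → Letter => if (fun j => (ofLex (a j)).2) = ε then
          (if IsAdmissible n D a then ∏ j, principalValue (a j) else 0) else 0) ∘ letterSeq ε =
          fun u => t ^ negCount ε *
            if Compatible (· < ·) (superDes n D ε) u then q ^ ∑ j, u j else 0 := by
        funext u
        rw [Function.comp_apply, if_pos (show (fun j => (ofLex (letterSeq ε u j)).2) = ε from rfl),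
          prod_principalValue_letterSeq, mul_ite, mul_zero]
        simp only [isAdmissible_letterSeq]
      rwa [e]
  have h := hasSum_sum (s := Finset.univ) fun ε _ => key ε
  simpa only [Finset.sum_ite_eq, Finset.mem_univ, if_true] using h

theorem prod_content {n : ℕ} (a : Fin n → Letter) :
    ((content a).prod fun b k => principalValue b ^ k) = ∏ j, principalValue (a j) := by
  rw [content, ← Finsupp.prod_finsetSum_index (fun _ => pow_zero _) fun _ _ _ => pow_add _ _ _]
  refine Finset.prod_congr rfl fun j _ => ?_
  exact (Finsupp.prod_single_index (h := fun b k => principalValue b ^ k) (pow_zero _)).trans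
    (pow_one (principalValue (a j)))

theorem isPrincipalSpecialization_superQ (n : ℕ) (D : Finset ℕ) :
    IsPrincipalSpecialization (superQ n D) (∑ ε : Fin n → Bool, t ^ negCount ε *
        (((pochhammerUnit n)⁻¹ : QTˣ) * q ^ ∑ i ∈ superDes n D ε, (n - i))) := by
  classical
  -- The sum over sequences is regrouped by monomial. Each fiber is finite, and its admissible
  -- members are counted by the coefficient.
  have h := (Equiv.sigmaFiberEquiv (content (n := n))).hasSum_iff.2 (hasSum_isAdmissible n D)
  refine h.sigma fun m => ?_
  have : Fintype {a : Fin n → Letter // content a = m} := (finite_content_eq n m).fintype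
  convert! hasSum_fintype _ using 1
  have e : ∀ a : {a : Fin n → Letter // content a = m},
      (((fun a : Fin n → Letter => if IsAdmissible n D a then ∏ j, principalValue (a j) else 0) ∘
        Equiv.sigmaFiberEquiv content) ⟨m, a⟩) =
        if IsAdmissible n D a.1 then m.prod fun b k => principalValue b ^ k else 0 := by
    rintro ⟨a, rfl⟩
    rw [prod_content]
    rfl
  simp only [e]
  rw [← Finset.sum_filter, Finset.sum_const]
  have hcard : MvPowerSeries.coeff m (superQ n D) =
      ((Finset.univ.filter fun a : {a : Fin n → Letter // content a = m} =>
        IsAdmissible n D a.1).card : ℤ) := by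
    change ((Set.ncard _ : ℕ) : ℤ) = _
    congr 1
    rw [← Finset.card_map (Function.Embedding.subtype _), ← Set.ncard_coe_finset]
    congr 1
    ext a
    simp
  rw [hcard, natCast_zsmul]

theorem isPrincipalSpecialization_superSchur (μ : YoungDiagram) :
    IsPrincipalSpecialization (superSchur μ) (((pochhammerUnit μ.card)⁻¹ : QTˣ) *
      ∑ T : StandardTableau μ, ∑ ε : Fin μ.card → Bool,
        t ^ negCount ε * q ^ ∑ i ∈ superDes μ.card T.des ε, (μ.card - i)) := by
  have h := hasSum_sum (s := Finset.univ) fun (T : StandardTableau μ) _ =>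
    isPrincipalSpecialization_superQ μ.card T.des
  simp only [Finset.mul_sum, mul_left_comm ((((pochhammerUnit μ.card)⁻¹ : QTˣ) : QT))]
  refine HasSum.congr_fun h fun m => ?_
  rw [superSchur, map_sum, Finset.sum_smul]

end SuperTableau

end

open SuperTableau in
theorem theorem5p10 (n : ℕ) (lam : YoungDiagram) (hlam : lam.card = n) :
    IsPrincipalSpecialization (superSchur lam)
      (((pochhammerUnit n)⁻¹ : QTˣ) *
        ∑ T : StandardSuperTableau lam, q ^ T.comaj * t ^ T.neg) ∧
    IsPrincipalSpecialization (superSchur lam)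
      (((pochhammerUnit n)⁻¹ : QTˣ) *
        ∑ T : StandardSuperTableau lam, q ^ T.maj * t ^ T.neg) := by
  subst hlam
  have hc : ∑ T : StandardSuperTableau lam, q ^ T.comaj * t ^ T.neg =
      ∑ T : StandardTableau lam, ∑ ε : Fin lam.card → Bool,
        t ^ negCount ε * q ^ ∑ i ∈ superDes lam.card T.des ε, (lam.card - i) := by
    rw [← StandardSuperTableau.sum_eq_sum_signs]
    refine Finset.sum_congr rfl fun T _ => ?_
    rw [StandardSuperTableau.comaj, T.des_eq_superDes, T.neg_eq_negCount, mul_comm]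
  have hm : ∑ T : StandardSuperTableau lam, q ^ T.maj * t ^ T.neg =
      ∑ T : StandardTableau lam, ∑ ε : Fin lam.card → Bool,
        t ^ negCount ε * q ^ ∑ i ∈ superDes lam.card T.des ε, i := by
    rw [← StandardSuperTableau.sum_eq_sum_signs
      (f := fun T ε => t ^ negCount ε * q ^ ∑ i ∈ superDes lam.card T.des ε, i)]
    refine Finset.sum_congr rfl fun T _ => ?_
    rw [StandardSuperTableau.maj, T.des_eq_superDes, T.neg_eq_negCount, mul_comm]
  have h := isPrincipalSpecialization_superSchur lam
  refine ⟨hc ▸ h, ?_⟩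
  rw [hm, ← sum_comaj_eq_sum_maj]
  exact h
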